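/- Let $n,\mu$ be nonnegative integers, $m=2\mu$, and $J=\begin{bmatrix}0&1\\-1&0\end{bmatrix}\otimes I_\mu$. Let $W=(W_1,\dots,W_m)$ be the quantum Wiener process on the symmetric Fock space $\mathfrak F$ over $L^2([0,\infty),\mathbb C^\mu)$, consisting of the position and momentum type quadratures of $\mu$ bosonic field channels, normalized by $W(0)=\mathcal I$ (a vector of identity operators), so that $[W(s),W(t)^{\rm T}]=2i\min(s,t)J$. Let $\mathfrak H_0$ be a complex Hilbert space and $X_0$ a vector of $n$ self-adjoint operators on $\mathfrak H_0$ satisfying the Weyl canonical commutation relations $e^{iu^{\rm T}X_0}e^{iv^{\rm T}X_0}=e^{-iu^{\rm T}\Theta v}e^{i(u+v)^{\rm T}X_0}$, $u,v\in\mathbb R^n$ (infinitesimally, $[X_0,X_0^{\rm T}]=2i\Theta$), where $\Theta$ is a nonsingular real antisymmetric $n\times n$ matrix. Consider the open quantum harmonic oscillator on $\mathfrak H_0\otimes\mathfrak F$ whose system variables $X=(X_1,\dots,X_n)$ satisfy $$dX=AX\,dt+B\,dW,\qquad X(0)=X_0,\qquad A=2\Theta(R+M^{\rm T}JM),\quad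 B=2\Theta M^{\rm T},$$ with $R=R^{\rm T}\in\mathbb R^{n\times n}$, $M\in\mathbb R^{m\times n}$, and suppose that $A$ is Hurwitz. Fix $T>0$ and, for $k=0,1,2,\dots$, put $$\omega_k=\tfrac{\pi}{T}\left(k+\tfrac12\right),\quad f_k(t)=\sqrt{\tfrac2T}\sin(\omega_kt),\quad g_k(t)=\sqrt{\tfrac2T}\cos(\omega_kt),\quad w_k=\omega_k\int_0^Tf_k(t)(W(t)-\mathcal I)\,dt,$$ $$\mho_k=(\omega_k^2I_n+A^2)^{-1},\qquad A_k=\sqrt{\tfrac2T}\,A\mho_k\left((-1)^ke^{TA}-\tfrac1{\omega_k}A\right).$$ All operators are considered on the common domain spanned by the vectors $u\otimes e(g)$, where $u$ belongs to the domains of all the entries of $X_0$ and $e(g)$ is an exponential vector of $\mathfrak F$; the stochastic equation is understood as the integral equation $X(t)=X_0+\int_0^tAX(s)\,ds+B(W(t)-W(0))$, $t\ge0$, on this domain, series of operators converge unconditionally in norm on each vector of this domain, and an operator on this domain is called a self-adjoint quantum variable if it is essentially self-adjoint there. Then the matrices $\mho_k$ are well defined, the series $$\xi=X_0+\sqrt{\tfrac2T}\sum_{k=0}^{\infty}A\mho_kBw_k$$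 converges, and with $$\alpha_k=A_k\xi+\omega_k\mho_kBw_k,\qquad\beta_k=-A\mho_kBw_k,$$ the entries of $\xi$, $\alpha_k$, $\beta_k$ and of $X(t)$ are self-adjoint quantum variables, and $$X(t)=\xi+\sum_{k=0}^{\infty}\bigl(f_k(t)\alpha_k+g_k(t)\beta_k\bigr),\qquad 0\le t\le T.$$ -/

import Mathlib

open scoped ComplexConjugate InnerProductSpace TensorProduct Kronecker Matrix

noncomputable section

section Fock

variable (E : Type*) [NormedAddCommGroup E] [InnerProductSpace ℂ E]

/-- The exponential kernel `(f, g) ↦ exp ⟪f, g⟫`. -/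
def expKernel : Matrix E E (ℂ →L[ℂ] ℂ) :=
  Matrix.of fun f g => Complex.exp ⟪f, g⟫_ℂ • ContinuousLinearMap.id ℂ ℂ

open scoped ComplexOrder in
/-- The powers of the inner product are positive semidefinite kernels. -/
theorem powKernel_nonneg (v : E →₀ ℂ) (n : ℕ) :
    0 ≤ (v.sum fun f a => v.sum fun g b => conj a * ⟪f, g⟫_ℂ ^ n * b).re := by
  have h : (Matrix.of fun f g : v.support => ⟪(f : E), (g : E)⟫_ℂ ^ n).PosSemidef := by
    induction n with
    | zero =>
      have h1 := Matrix.posSemidef_gram ℂ (fun _ : v.support => (1 : ℂ))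
      have h2 : (Matrix.of fun f g : v.support => ⟪(f : E), (g : E)⟫_ℂ ^ 0)
          = Matrix.gram ℂ (fun _ : v.support => (1 : ℂ)) := by
        ext f g
        simp [Matrix.gram]
      rw [h2]
      exact h1
    | succ n ih =>
      have h2 : (Matrix.of fun f g : v.support => ⟪(f : E), (g : E)⟫_ℂ ^ (n + 1))
          = (Matrix.of fun f g : v.support => ⟪(f : E), (g : E)⟫_ℂ ^ n).hadamard
            (Matrix.gram ℂ fun f : v.support => (f : E)) := by
        ext f g
        simp [Matrix.gram, pow_succ]
      rw [h2]
      exact ih.hadamard (Matrix.posSemidef_gram ℂ _)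
  have h3 := h.dotProduct_mulVec_nonneg fun f => v f
  have h4 : 0 ≤ Complex.re _ := (Complex.le_def.1 h3).1
  convert h4 using 2
  simp only [Finsupp.sum, dotProduct, Matrix.mulVec, Matrix.of_apply, Pi.star_apply,
    Finset.univ_eq_attach, Finset.mul_sum]
  rw [← Finset.sum_attach]
  refine Finset.sum_congr rfl fun f _ => ?_
  rw [← Finset.sum_attach]
  refine Finset.sum_congr rfl fun g _ => ?_
  simp [mul_assoc]

theorem expKernel_posSemidef : (expKernel E).PosSemidef := by
  have h0 := (RKHS.posSemidef_tfae (K := expKernel E)).out 0 2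
  refine h0.2 ⟨?_, fun v => ?_⟩
  · ext f g
    simp [expKernel, Matrix.conjTranspose_apply, ContinuousLinearMap.star_eq_adjoint,
      ← Complex.exp_conj]
    change (ContinuousLinearMap.adjoint (1 : ℂ →L[ℂ] ℂ)) 1 = 1
    rw [← ContinuousLinearMap.star_eq_adjoint, star_one]
    rfl
  · have key : ∀ f g : E, HasSum
        (fun n : ℕ => ((n.factorial : ℝ))⁻¹ * (conj (v f) * ⟪f, g⟫_ℂ ^ n * v g).re)
        (conj (v f) * Complex.exp ⟪f, g⟫_ℂ * v g).re := by
      intro f g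
      have h := NormedSpace.expSeries_div_hasSum_exp (𝔸 := ℂ) ⟪f, g⟫_ℂ
      rw [← Complex.exp_eq_exp_ℂ] at h
      have h2 := Complex.hasSum_re ((h.mul_left (conj (v f))).mul_right (v g))
      convert h2 using 2 with n
      rw [← Complex.re_ofReal_mul]
      congr 1
      push_cast
      ring
    have h1 : HasSum (fun n : ℕ => ((n.factorial : ℝ))⁻¹ *
        (v.sum fun f a => v.sum fun g b => conj a * ⟪f, g⟫_ℂ ^ n * b).re)
        (v.sum fun f a => v.sum fun g b => conj a * Complex.exp ⟪f, g⟫_ℂ * b).re := by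
      simp only [Finsupp.sum, Complex.re_sum, Finset.mul_sum]
      exact hasSum_sum fun f _ => hasSum_sum fun g _ => key f g
    have h2 := h1.nonneg fun n => mul_nonneg (by positivity) (powKernel_nonneg E v n)
    refine h2.trans_eq ?_
    change Complex.re _ = Complex.re _
    congr 1
    simp only [Finsupp.sum]
    refine Finset.sum_congr rfl fun f _ => Finset.sum_congr rfl fun g _ => ?_
    simp [expKernel, ← Complex.exp_conj]
    ring
instance : Fact (expKernel E).PosSemidef := ⟨expKernel_posSemidef E⟩

/-- The symmetric Fock space over the one-particle Hilbert space `E`, realized as the Hilbert space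
whose reproducing kernel is the exponential kernel. It is the closed span of the
exponential (coherent) vectors `expVec g`, which satisfy `⟪expVec f, expVec g⟫ = exp ⟪f, g⟫`. -/
def FockSpace : Type _ := RKHS.OfKernel (expKernel E)

instance : NormedAddCommGroup (FockSpace E) :=
  inferInstanceAs (NormedAddCommGroup (RKHS.OfKernel (expKernel E)))
instance : InnerProductSpace ℂ (FockSpace E) :=
  inferInstanceAs (InnerProductSpace ℂ (RKHS.OfKernel (expKernel E)))
instance : CompleteSpace (FockSpace E) :=
  inferInstanceAs (CompleteSpace (RKHS.OfKernel (expKernel E)))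
instance : RKHS ℂ (FockSpace E) E ℂ :=
  inferInstanceAs (RKHS ℂ (RKHS.OfKernel (expKernel E)) E ℂ)

variable {E}

/-- The exponential vector of `g`; in terms of symmetric tensors it is `⨁ₙ g^{⊗n} / √n!`. -/
def expVec (g : E) : FockSpace E := RKHS.kerFun (FockSpace E) g (1 : ℂ)

theorem expVec_apply (f g : E) : expVec g f = Complex.exp ⟪f, g⟫_ℂ := by
  have h : RKHS.kernel (FockSpace E) = expKernel E := RKHS.OfKernel.kernel_ofKernel
  rw [expVec, RKHS.kerFun_apply, h]
  simp [expKernel]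

theorem inner_expVec (f g : E) : ⟪expVec f, expVec g⟫_ℂ = Complex.exp ⟪f, g⟫_ℂ := by
  rw [← expVec_apply]
  conv_lhs => rw [expVec]
  simp

/-- Distinct exponential vectors are linearly independent. -/
theorem linearIndependent_expVec : LinearIndependent ℂ (expVec : E → FockSpace E) := by
  let χ : E → (Multiplicative E →* ℂ) := fun g =>
    { toFun := fun f => Complex.exp (conj ⟪g, f.toAdd⟫_ℂ)
      map_one' := by simp
      map_mul' := fun f f' => by simp [Complex.exp_add, -inner_conj_symm] }
  have hχ : Function.Injective χ := by
    intro g g' h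
    by_contra hne
    have hk : ∀ z : ℂ, Complex.exp (z * ⟪g, g - g'⟫_ℂ) = Complex.exp (z * ⟪g', g - g'⟫_ℂ) := by
      intro z
      have h1 := DFunLike.congr_fun h (Multiplicative.ofAdd (z • (g - g')))
      have h2 := congrArg conj h1
      simpa only [χ, MonoidHom.coe_mk, OneHom.coe_mk, toAdd_ofAdd, inner_smul_right,
        ← Complex.exp_conj, Complex.conj_conj] using h2
    have hd : ∀ c : ℂ, HasDerivAt (fun z : ℂ => Complex.exp (z * c)) c 0 := by
      intro c
      have h1 := ((hasDerivAt_id (0 : ℂ)).mul_const c).cexp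
      simpa using h1
    have h1 := (hd ⟪g, g - g'⟫_ℂ).unique (by simpa only [hk] using hd ⟪g', g - g'⟫_ℂ)
    have h2 : ⟪g - g', g - g'⟫_ℂ = 0 := by
      rw [inner_sub_left, h1, sub_self]
    exact hne (sub_eq_zero.1 (inner_self_eq_zero.1 h2))
  have h1 := (linearIndependent_monoidHom (Multiplicative E) ℂ).comp χ hχ
  let ev : FockSpace E →ₗ[ℂ] (Multiplicative E → ℂ) :=
    { toFun := fun Φ f => Φ f.toAdd
      map_add' := fun Φ Ψ => by ext; simp
      map_smul' := fun c Φ => by ext; simp }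
  refine LinearIndependent.of_comp ev ?_
  have h2 : ev ∘ (expVec : E → FockSpace E) = fun g f => χ g f := by
    ext g f
    simp [ev, χ, expVec_apply]
  rw [h2]
  exact h1

variable (E) in
/-- The exponential domain: the span of the exponential vectors. -/
def expDomain : Submodule ℂ (FockSpace E) := Submodule.span ℂ (Set.range expVec)

/-- The annihilation operator of `h` on the exponential domain, `a(h) e(g) = ⟪h, g⟫ e(g)`. -/
def annihilationOp (h : E) : expDomain E →ₗ[ℂ] FockSpace E :=
  Finsupp.linearCombination ℂ (fun g => ⟪h, g⟫_ℂ • expVec g) ∘ₗ linearIndependent_expVec.repr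

/-- The creation operator of `h` on the exponential domain; `a†(h) e(g)` is the derivative of
`z ↦ e(g + z h)` at `z = 0`. -/
def creationOp (h : E) : expDomain E →ₗ[ℂ] FockSpace E :=
  Finsupp.linearCombination ℂ (fun g => fderiv ℂ expVec g h) ∘ₗ linearIndependent_expVec.repr

/-- The field operator `a(h) + a†(h)`, for which `[φ(f), φ(h)] = 2 i Im ⟪f, h⟫`. -/
def fieldOp (h : E) : expDomain E →ₗ[ℂ] FockSpace E := annihilationOp h + creationOp h

theorem continuous_fieldOp (x : expDomain E) : Continuous fun h : E => fieldOp h x := by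
  have h : ∀ h : E, fieldOp h x = ∑ g ∈ (linearIndependent_expVec.repr x).support,
      linearIndependent_expVec.repr x g • (⟪h, g⟫_ℂ • expVec g + fderiv ℂ expVec g h) := by
    intro h
    simp only [smul_add, Finset.sum_add_distrib]
    rfl
  simp only [h]
  refine continuous_finsetSum _ fun g _ => ?_
  have h1 : Continuous fun h : E => ⟪h, g⟫_ℂ • expVec g + fderiv ℂ expVec g h := by fun_prop
  exact Continuous.smul (f := fun _ => linearIndependent_expVec.repr x g) continuous_const h1

end Fock

section Domain

variable {H₀ : Type*} [NormedAddCommGroup H₀] [InnerProductSpace ℂ H₀]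
variable {E : Type*} [NormedAddCommGroup E] [InnerProductSpace ℂ E]

variable (H₀ E) in
/-- The system-field space: the Hilbert space tensor product of the initial space `H₀` and the Fock
space over `E`. -/
abbrev SystemFieldSpace : Type _ := UniformSpace.Completion (H₀ ⊗[ℂ] FockSpace E)

variable (H₀ E) in
/-- The inclusion of the algebraic tensor product into the Hilbert space tensor product. -/
def toSystemField : H₀ ⊗[ℂ] FockSpace E →ₗ[ℂ] SystemFieldSpace H₀ E :=
  (UniformSpace.Completion.toComplL : H₀ ⊗[ℂ] FockSpace E →L[ℂ] SystemFieldSpace H₀ E)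

variable (E) in
/-- The inclusion of the algebraic tensor product of `P` and the exponential domain. -/
def domainIncl (P : Submodule ℂ H₀) : P ⊗[ℂ] expDomain E →ₗ[ℂ] SystemFieldSpace H₀ E :=
  toSystemField H₀ E ∘ₗ TensorProduct.mapIncl P (expDomain E)

variable (E) in
theorem domainIncl_injective (P : Submodule ℂ H₀) : Function.Injective (domainIncl E P) := by
  refine Function.Injective.comp (g := toSystemField H₀ E)
    (UniformSpace.Completion.coe_injective (H₀ ⊗[ℂ] FockSpace E)) (LinearMap.ker_eq_bot.1 ?_)
  refine LinearMap.ker_eq_bot'.2 fun x hx => ?_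
  have h := TensorProduct.inner_mapIncl_mapIncl (𝕜 := ℂ) P (expDomain E) x x
  rw [hx, inner_zero_left] at h
  exact (inner_self_eq_zero (𝕜 := ℂ) (E := P ⊗[ℂ] expDomain E)).1 h.symm

variable (E) in
/-- The domain in the system-field space spanned by the vectors `u ⊗ e(g)` with `u ∈ P`. -/
def tensorDomain (P : Submodule ℂ H₀) : Submodule ℂ (SystemFieldSpace H₀ E) :=
  LinearMap.range (domainIncl E P)

variable (E) in
/-- The domain `tensorDomain E P` is the algebraic tensor product of `P` and the exponential
domain. -/
def tensorDomainEquiv (P : Submodule ℂ H₀) : (P ⊗[ℂ] expDomain E) ≃ₗ[ℂ] tensorDomain E P :=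
  LinearEquiv.ofInjective (domainIncl E P) (domainIncl_injective E P)

/-- The operator `S ⊗ 1` on `tensorDomain E P`. -/
def systemAmpl {P : Submodule ℂ H₀} (S : P →ₗ[ℂ] H₀) :
    tensorDomain E P →ₗ[ℂ] SystemFieldSpace H₀ E :=
  toSystemField H₀ E ∘ₗ TensorProduct.map S (expDomain E).subtype ∘ₗ
    (tensorDomainEquiv E P).symm.toLinearMap

/-- The operator `1 ⊗ S` on `tensorDomain E P`. -/
def fieldAmpl (P : Submodule ℂ H₀) (S : expDomain E →ₗ[ℂ] FockSpace E) :
    tensorDomain E P →ₗ[ℂ] SystemFieldSpace H₀ E :=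
  toSystemField H₀ E ∘ₗ TensorProduct.map P.subtype S ∘ₗ
    (tensorDomainEquiv E P).symm.toLinearMap

theorem continuous_fieldAmpl (P : Submodule ℂ H₀) (ψ : tensorDomain E P) :
    Continuous fun h : E => fieldAmpl P (fieldOp h) ψ := by
  obtain ⟨x, rfl⟩ := (tensorDomainEquiv E P).surjective ψ
  simp only [fieldAmpl, LinearMap.comp_apply, LinearEquiv.coe_coe, LinearEquiv.symm_apply_apply]
  refine (UniformSpace.Completion.toComplL :
    H₀ ⊗[ℂ] FockSpace E →L[ℂ] SystemFieldSpace H₀ E).continuous.comp ?_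
  induction x using TensorProduct.induction_on with
  | zero => simpa using continuous_const
  | tmul u v =>
    simp only [TensorProduct.map_tmul]
    exact (TensorProduct.continuous_tmul (𝕜 := ℂ)).comp
      (continuous_const.prodMk (continuous_fieldOp v))
  | add x y hx hy => 
    simp only [map_add]
    exact Continuous.add hx hy

/-- A densely defined operator on a Hilbert space is essentially self-adjoint if its closure is
self-adjoint. -/
def IsEssentiallySelfAdjoint {H : Type*} [NormedAddCommGroup H] [InnerProductSpace ℂ H]
    [CompleteSpace H] (S : H →ₗ.[ℂ] H) : Prop :=
  Dense (S.domain : Set H) ∧ S.IsClosable ∧ IsSelfAdjoint S.closure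

/-- An operator with domain `D` represents a self-adjoint quantum variable (its closure) if it is
essentially self-adjoint on `D`. -/
def IsQuantumVariable {H : Type*} [NormedAddCommGroup H] [InnerProductSpace ℂ H]
    [CompleteSpace H] {D : Submodule ℂ H} (S : D →ₗ[ℂ] H) : Prop :=
  IsEssentiallySelfAdjoint (⟨D, S⟩ : H →ₗ.[ℂ] H)

/-- The product of a real matrix and a column vector whose entries are operators. -/
def opMulVec {ι κ H : Type*} [Fintype κ] [AddCommGroup H] [Module ℂ H] {D : Submodule ℂ H}
    (M : Matrix ι κ ℝ) (V : κ → (D →ₗ[ℂ] H)) : ι → (D →ₗ[ℂ] H) :=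
  fun i => ∑ k, (M i k : ℂ) • V k

end Domain

section Weyl

variable {H₀ : Type*} [NormedAddCommGroup H₀] [InnerProductSpace ℂ H₀]

/-- The Stone generator `-i (d/dt) U(t) |_{t = 0}` of a one-parameter family of operators, on its
natural domain. If `U` is a strongly continuous unitary group, then this is the self-adjoint
operator `S` with `U(t) = exp(i t S)`. -/
def stoneGenerator (U : ℝ → H₀ →L[ℂ] H₀) : H₀ →ₗ.[ℂ] H₀ where
  domain :=
    { carrier := {ψ | DifferentiableAt ℝ (fun t => U t ψ) 0}
      add_mem' := fun {ψ χ} hψ hχ => by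
        simpa only [Set.mem_ofPred_eq, map_add] using DifferentiableAt.fun_add hψ hχ
      zero_mem' := by simp
      smul_mem' := fun c ψ hψ => by
        simpa only [Set.mem_ofPred_eq, map_smul] using DifferentiableAt.fun_const_smul hψ c }
  toFun :=
    { toFun := fun ψ => -Complex.I • deriv (fun t => U t ψ) 0
      map_add' := fun ψ χ => by
        simp only [Submodule.coe_add, map_add]
        rw [deriv_fun_add ψ.2 χ.2, smul_add]
      map_smul' := fun c ψ => by
        simp only [Submodule.coe_smul, map_smul, RingHom.id_apply]
        rw [deriv_fun_const_smul c ψ.2, smul_comm] }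

/-- The operators `X₀ 0, …, X₀ (n - 1)` are self-adjoint operators on `H₀` which satisfy the Weyl
canonical commutation relations with the matrix `Θ` (in the infinitesimal form,
`[X₀, X₀ᵀ] = 2 i Θ`): here `U u` is the unitary operator `exp(i uᵀ X₀)`. -/
def SatisfiesWeylCCR [CompleteSpace H₀] {n : ℕ} (Θ : Matrix (Fin n) (Fin n) ℝ)
    (X₀ : Fin n → H₀ →ₗ.[ℂ] H₀) : Prop :=
  ∃ U : (Fin n → ℝ) → H₀ →L[ℂ] H₀,
    (∀ u, U u ∈ unitary (H₀ →L[ℂ] H₀)) ∧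
    (∀ ψ, Continuous fun u => U u ψ) ∧
    (∀ u v, U u * U v = Complex.exp (-Complex.I * ((u ⬝ᵥ Θ *ᵥ v : ℝ) : ℂ)) • U (u + v)) ∧
    ∀ j, X₀ j = stoneGenerator fun t => U (Pi.single j t)

/-- The common domain of the operators `X₀ j`. -/
def initialDomain {n : ℕ} (X₀ : Fin n → H₀ →ₗ.[ℂ] H₀) : Submodule ℂ H₀ :=
  ⨅ j, (X₀ j).domain

end Weyl

section Wiener

open MeasureTheory

/-- The one-particle space `L²([0, ∞), ℂ^μ)` of `μ` field channels. -/
abbrev OneParticle (μ : ℕ) : Type :=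
  Lp (EuclideanSpace ℂ (Fin μ)) 2 (volume.restrict (Set.Ici (0 : ℝ)))

variable {μ n : ℕ} {H₀ : Type*} [NormedAddCommGroup H₀] [InnerProductSpace ℂ H₀]

/-- The test function `1_[0,t] c_k` of the `k`-th field variable, where `c_(0,j)` is the `j`-th
basis vector of `ℂ^μ` (position type quadrature), and `c_(1,j)` is this vector times `i`
(momentum type quadrature). -/
def wienerTest (t : ℝ) (k : Fin 2 × Fin μ) : OneParticle μ :=
  indicatorConstLp 2 (measurableSet_Icc : MeasurableSet (Set.Icc 0 t))
    ((Measure.restrict_apply_le _ _).trans_lt measure_Icc_lt_top).ne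
    (EuclideanSpace.single k.2 (if k.1 = 0 then 1 else Complex.I))

theorem continuous_wienerTest (k : Fin 2 × Fin μ) : Continuous fun t => wienerTest t k := by
  refine continuous_indicatorConstLp_set (by simp) fun x => ?_
  have hle : ∀ y : ℝ, (volume.restrict (Set.Ici (0 : ℝ)))
      (symmDiff (Set.Icc 0 y) (Set.Icc 0 x)) ≤ ENNReal.ofReal |y - x| := by
    intro y
    refine (Measure.restrict_apply_le _ _).trans ?_
    refine (measure_mono (t := Set.Icc (min x y) (max x y)) ?_).trans ?_
    · intro s hs
      rcases hs with ⟨h1, h2⟩ | ⟨h1, h2⟩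
      · simp only [Set.mem_Icc, not_and, not_le] at h1 h2 ⊢
        exact ⟨(min_le_left _ _).trans (h2 h1.1).le, h1.2.trans (le_max_right _ _)⟩
      · simp only [Set.mem_Icc, not_and, not_le] at h1 h2 ⊢
        exact ⟨(min_le_right _ _).trans (h2 h1.1).le, h1.2.trans (le_max_left _ _)⟩
    · rw [Real.volume_Icc, max_sub_min_eq_abs]
  refine tendsto_of_tendsto_of_tendsto_of_le_of_le tendsto_const_nhds ?_ (fun _ => zero_le) hle
  have h : Filter.Tendsto (fun y : ℝ => ENNReal.ofReal |y - x|) (nhds x)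
      (nhds (ENNReal.ofReal |x - x|)) :=
    (ENNReal.continuous_ofReal.comp (by fun_prop)).tendsto x
  simpa using h

/-- Operators on the system-field space, defined on the span of the vectors `u ⊗ e(g)`, where `u`
belongs to the domains of all the initial system variables. -/
abbrev DomainOp (μ : ℕ) (X₀ : Fin n → H₀ →ₗ.[ℂ] H₀) : Type _ :=
  tensorDomain (OneParticle μ) (initialDomain X₀) →ₗ[ℂ] SystemFieldSpace H₀ (OneParticle μ)

/-- The initial system variables `X₀ j ⊗ 1`. -/
def initialOp (μ : ℕ) (X₀ : Fin n → H₀ →ₗ.[ℂ] H₀) (j : Fin n) : DomainOp μ X₀ :=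
  systemAmpl ((X₀ j).toFun ∘ₗ Submodule.inclusion (iInf_le _ j))

/-- The quantum Wiener process `W` of `m = 2 μ` channels, normalized so that its entries at `t = 0`
are the identity operator. The entries `(0, j)` and `(1, j)` are the quadratures of the `j`-th field
channel, and `[W(s), W(t)ᵀ] = 2 i min(s,t) J`. -/
def wiener (X₀ : Fin n → H₀ →ₗ.[ℂ] H₀) (t : ℝ) (k : Fin 2 × Fin μ) : DomainOp μ X₀ :=
  Submodule.subtype _ + fieldAmpl _ (fieldOp (wienerTest t k))

theorem continuous_wiener (X₀ : Fin n → H₀ →ₗ.[ℂ] H₀) (k : Fin 2 × Fin μ)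
    (ψ : tensorDomain (OneParticle μ) (initialDomain X₀)) :
    Continuous fun t => wiener X₀ t k ψ :=
  continuous_const.add ((continuous_fieldAmpl _ ψ).comp (continuous_wienerTest k))

/-- The frequencies `ω_k`. -/
def freq (T : ℝ) (k : ℕ) : ℝ := Real.pi / T * (k + 1 / 2)

/-- The sine functions `f_k`. -/
def sineFun (T : ℝ) (k : ℕ) (t : ℝ) : ℝ := √(2 / T) * Real.sin (freq T k * t)

theorem continuous_sineFun (T : ℝ) (k : ℕ) : Continuous (sineFun T k) := by
  unfold sineFun
  fun_prop

/-- The cosine functions `g_k`. -/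
def cosineFun (T : ℝ) (k : ℕ) (t : ℝ) : ℝ := √(2 / T) * Real.cos (freq T k * t)

/-- The coefficients of the Karhunen-Loeve expansion of the quantum Wiener process,
`w_k = ω_k ∫_0^T f_k(t) (W(t) - W(0)) dt`, with the integral applied to each vector of the domain. -/
def qklCoeff (X₀ : Fin n → H₀ →ₗ.[ℂ] H₀) (T : ℝ) (k : ℕ) (j : Fin 2 × Fin μ) :
    DomainOp μ X₀ where
  toFun ψ := (freq T k : ℂ) • ∫ t in (0 : ℝ)..T, (sineFun T k t : ℂ) • (wiener X₀ t j ψ - ψ)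
  map_add' ψ χ := by
    have h : ∀ ψ : tensorDomain (OneParticle μ) (initialDomain X₀), IntervalIntegrable
        (fun t => (sineFun T k t : ℂ) • (wiener X₀ t j ψ - ψ)) volume 0 T := fun ψ =>
      (Continuous.smul (Complex.continuous_ofReal.comp (continuous_sineFun T k))
        ((continuous_wiener X₀ j ψ).sub continuous_const)).intervalIntegrable _ _
    rw [← smul_add, ← intervalIntegral.integral_add (h ψ) (h χ)]
    congr 2
    funext t
    rw [map_add, Submodule.coe_add, add_sub_add_comm, smul_add]
  map_smul' c ψ := by
    rw [RingHom.id_apply, smul_comm c (freq T k : ℂ), ← intervalIntegral.integral_smul c]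
    congr 2
    funext t
    rw [map_smul, Submodule.coe_smul, ← smul_sub, smul_comm c]

end Wiener

section OQHO

variable {μ n : ℕ}

/-- The matrix `J = [0, 1; -1, 0] ⊗ I_μ`. -/
def fieldCCRMatrix (μ : ℕ) : Matrix (Fin 2 × Fin μ) (Fin 2 × Fin μ) ℝ :=
  !![0, 1; -1, 0] ⊗ₖ (1 : Matrix (Fin μ) (Fin μ) ℝ)

/-- The drift matrix `A = 2 Θ (R + Mᵀ J M)`. -/
def driftMatrix (Θ R : Matrix (Fin n) (Fin n) ℝ) (M : Matrix (Fin 2 × Fin μ) (Fin n) ℝ) :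
    Matrix (Fin n) (Fin n) ℝ :=
  (2 : ℝ) • (Θ * (R + Mᵀ * fieldCCRMatrix μ * M))

/-- The dispersion matrix `B = 2 Θ Mᵀ`. -/
def dispersionMatrix (Θ : Matrix (Fin n) (Fin n) ℝ) (M : Matrix (Fin 2 × Fin μ) (Fin n) ℝ) :
    Matrix (Fin n) (Fin 2 × Fin μ) ℝ :=
  (2 : ℝ) • (Θ * Mᵀ)

/-- A real matrix is Hurwitz if all its eigenvalues have negative real parts. -/
def IsHurwitz (A : Matrix (Fin n) (Fin n) ℝ) : Prop :=
  ∀ z ∈ spectrum ℂ (A.map Complex.ofReal), z.re < 0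

/-- The process `X` is a solution of the linear quantum stochastic differential equation
`dX = A X dt + B dW` with the initial value `X₀`, that is,
`X(t) = X₀ + ∫_0^t A X(s) ds + B (W(t) - W(0))` for all `t ≥ 0` as operators on the domain. -/
structure IsQSDESolution {H₀ : Type*} [NormedAddCommGroup H₀] [InnerProductSpace ℂ H₀]
    (A : Matrix (Fin n) (Fin n) ℝ) (B : Matrix (Fin n) (Fin 2 × Fin μ) ℝ)
    (X₀ : Fin n → H₀ →ₗ.[ℂ] H₀) (X : ℝ → Fin n → DomainOp μ X₀) : Prop where
  intervalIntegrable : ∀ t, 0 ≤ t → ∀ j ψ,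
    IntervalIntegrable (fun s => X s j ψ) MeasureTheory.volume 0 t
  integral_eq : ∀ t, 0 ≤ t → ∀ i ψ,
    X t i ψ = initialOp μ X₀ i ψ + (∫ s in (0 : ℝ)..t, opMulVec A (X s) i ψ)
      + opMulVec B (fun k => wiener X₀ t k - wiener X₀ 0 k) i ψ

/-- The matrix `ω_k² I + A²`, whose inverse is `℧_k`. -/
def mhoInv (A : Matrix (Fin n) (Fin n) ℝ) (T : ℝ) (k : ℕ) : Matrix (Fin n) (Fin n) ℝ :=
  freq T k ^ 2 • (1 : Matrix (Fin n) (Fin n) ℝ) + A ^ 2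

/-- The matrix `℧_k = (ω_k² I + A²)⁻¹`. -/
def mho (A : Matrix (Fin n) (Fin n) ℝ) (T : ℝ) (k : ℕ) : Matrix (Fin n) (Fin n) ℝ :=
  (mhoInv A T k)⁻¹

/-- The matrix `A_k = √(2/T) A ℧_k ((-1)^k exp(T A) - ω_k⁻¹ A)`. -/
def expCoeff (A : Matrix (Fin n) (Fin n) ℝ) (T : ℝ) (k : ℕ) : Matrix (Fin n) (Fin n) ℝ :=
  √(2 / T) • (A * mho A T k * ((-1 : ℝ) ^ k • NormedSpace.exp (T • A) - (freq T k)⁻¹ • A))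

end OQHO

end

/-
In the one-particle space the Wiener process is a curve with covariance `min s t`, whose
Karhunen-Loeve coefficients along `√(2/T) sin (ω_k t)` are orthonormal, and taking field operators
is linear and continuous on every vector of the domain. The quantum stochastic equation is therefore
a linear equation for vectors of a Hilbert space, and it can be solved termwise: the `k`-th
coefficient drives a harmonic forced motion with frequency `ω_k`, and summing these motions leaves
the free motion `exp (t A) ξ`, which is expanded in the sines through `exp (t A) - 1`.

Every operator that occurs is a real affine combination of the initial variables plus a field
operator. It generates a group of isometries, Weyl operators tensor displacement operators, that
leave the common domain invariant, and this forces its deficiency spaces to be trivial.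
-/

noncomputable section

section ExponentialGrowth

variable {E : Type*} [NormedAddCommGroup E] [NormedSpace ℝ E] {r : ℝ} {f : ℝ → E}

theorem eq_exp_smul_of_hasDerivAt (hf : ∀ t, HasDerivAt f (r • f t) t) (t : ℝ) :
    f t = Real.exp (r * t) • f 0 := by
  have hderiv : ∀ t, HasDerivAt (fun t => Real.exp (-(r * t)) • f t) 0 t := by
    intro t
    have hexp : HasDerivAt (fun t => Real.exp (-(r * t))) (Real.exp (-(r * t)) * (-r)) t := by
      simpa using ((hasDerivAt_id t).const_mul r).neg.exp
    refine (hexp.smul (hf t)).congr_deriv ?_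
    rw [smul_smul, ← add_smul]
    simp
  have hconst : Real.exp (-(r * t)) • f t = f 0 := by
    simpa using is_const_of_deriv_eq_zero (fun t => (hderiv t).differentiableAt)
      (fun t => (hderiv t).deriv) t 0
  rw [← hconst, smul_smul, ← Real.exp_add, add_neg_cancel, Real.exp_zero, one_smul]

theorem eq_zero_of_hasDerivAt_of_norm_le {C : ℝ} (hr : r ≠ 0) (hf : ∀ t, HasDerivAt f (r • f t) t)
    (hC : ∀ t, ‖f t‖ ≤ C) : f 0 = 0 := by
  have hlim : Filter.Tendsto (fun s => Real.exp (-s) * C) Filter.atTop (nhds 0) := by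
    simpa using Real.tendsto_exp_neg_atTop_nhds_zero.mul_const C
  refine norm_le_zero_iff.1 (ge_of_tendsto' hlim fun s => ?_)
  have h := eq_exp_smul_of_hasDerivAt hf (s / r)
  rw [mul_div_cancel₀ _ hr] at h
  calc ‖f 0‖ = Real.exp (-s) * ‖f (s / r)‖ := by
        rw [h, norm_smul, Real.norm_of_nonneg (Real.exp_pos s).le, ← mul_assoc, ← Real.exp_add,
          neg_add_cancel, Real.exp_zero, one_mul]
    _ ≤ Real.exp (-s) * C := mul_le_mul_of_nonneg_left (hC _) (Real.exp_pos _).le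

end ExponentialGrowth

section EssentialSelfAdjointness

variable {H : Type*} [NormedAddCommGroup H] [InnerProductSpace ℂ H]

/-- The deficiency space `ran (L - w)ᗮ` of an operator `L` is trivial. For symmetric `L`, this
property at `w = ± i` is equivalent to essential self-adjointness. -/
def HasTrivialDeficiency (L : H →ₗ.[ℂ] H) (w : ℂ) : Prop :=
  ∀ φ : H, (∀ ψ : L.domain, ⟪φ, L ψ⟫_ℂ = w * ⟪φ, (ψ : H)⟫_ℂ) → φ = 0

variable {L : H →ₗ.[ℂ] H}

theorem eq_zero_of_mem_adjoint_graph_of_orthogonal (hpos : HasTrivialDeficiency L Complex.I)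
    (hneg : HasTrivialDeficiency L (-Complex.I)) {a b : H}
    (hadj : ∀ ψ : L.domain, ⟪b, (ψ : H)⟫_ℂ = ⟪a, L ψ⟫_ℂ)
    (horth : ∀ ψ : L.domain, ⟪a, (ψ : H)⟫_ℂ + ⟪b, L ψ⟫_ℂ = 0) : a = 0 ∧ b = 0 := by
  have hadd : b + Complex.I • a = 0 := hneg _ fun ψ => by
    rw [inner_add_left, inner_add_left, inner_smul_left, inner_smul_left, hadj, ← hadj,
      eq_neg_of_add_eq_zero_right (horth ψ), Complex.conj_I]
    linear_combination (-⟪a, (ψ : H)⟫_ℂ) * Complex.I_sq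
  have hsub : b - Complex.I • a = 0 := hpos _ fun ψ => by
    rw [inner_sub_left, inner_sub_left, inner_smul_left, inner_smul_left, hadj, ← hadj,
      eq_neg_of_add_eq_zero_right (horth ψ), Complex.conj_I]
    linear_combination (-⟪a, (ψ : H)⟫_ℂ) * Complex.I_sq
  have hb : b = 0 := by
    have h : (2 : ℂ) • b = 0 := by
      simpa [two_smul] using congrArg₂ (· + ·) hadd hsub
    simpa using h
  refine ⟨?_, hb⟩
  simpa [hb] using hadd

theorem inner_eq_of_mem_graph_of_mem_closure_graph {L' : H →ₗ.[ℂ] H} (h : L'.IsFormalAdjoint L)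
    {x y : H × H} (hx : x ∈ L'.graph) (hy : y ∈ L.graph.topologicalClosure) :
    ⟪x.2, y.1⟫_ℂ = ⟪x.1, y.2⟫_ℂ := by
  let C : Set (H × H) := {w | ⟪x.2, w.1⟫_ℂ = ⟪x.1, w.2⟫_ℂ}
  have hC : IsClosed C := isClosed_eq (by fun_prop) (by fun_prop)
  refine closure_minimal (s := (L.graph : Set (H × H))) (t := C) (fun w hw => ?_) hC hy
  obtain ⟨x', hx1, hx2⟩ := (LinearPMap.mem_graph_iff _).1 hx
  obtain ⟨w', hw1, hw2⟩ := (LinearPMap.mem_graph_iff _).1 hw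
  rw [Set.mem_ofPred_eq, ← hx1, ← hx2, ← hw1, ← hw2]
  exact h x' w'

variable {D : Submodule ℂ H} {S : D →ₗ[ℂ] H} {V : ℝ → D → D}

theorem hasTrivialDeficiency_of_hasDerivAt (hD : Dense (D : Set H)) (hV0 : ∀ ψ, V 0 ψ = ψ)
    (hVnorm : ∀ t ψ, ‖V t ψ‖ = ‖ψ‖)
    (hV : ∀ t ψ, HasDerivAt (fun s => (V s ψ : H)) (Complex.I • S (V t ψ)) t)
    {w : ℂ} {r : ℝ} (hr : r ≠ 0) (hw : Complex.I * w = r) : HasTrivialDeficiency ⟨D, S⟩ w := by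
  intro φ hφ
  refine hD.eq_zero_of_inner_left ℂ fun ψ hψ => ?_
  have hderiv : ∀ t, HasDerivAt (fun t => ⟪φ, (V t ⟨ψ, hψ⟩ : H)⟫_ℂ)
      (r • ⟪φ, (V t ⟨ψ, hψ⟩ : H)⟫_ℂ) t := by
    intro t
    refine ((hasDerivAt_const t φ).inner ℂ (hV t ⟨ψ, hψ⟩)).congr_deriv ?_
    rw [inner_zero_left, add_zero, inner_smul_right, Complex.real_smul, ← hw, mul_assoc]
    exact congrArg _ (hφ (V t ⟨ψ, hψ⟩))
  have h := eq_zero_of_hasDerivAt_of_norm_le hr hderiv fun t =>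
    (norm_inner_le_norm _ _).trans_eq (congrArg (‖φ‖ * ·) (hVnorm t ⟨ψ, hψ⟩))
  simpa only [hV0] using h

variable [CompleteSpace H]

theorem adjoint_closure_eq_adjoint (hL : Dense (L.domain : Set H)) (hcl : L.IsClosable) :
    L.closure.adjoint = L.adjoint := by
  have hdense : Dense (L.closure.domain : Set H) := hL.mono (LinearPMap.le_closure L).1
  refine le_antisymm (LinearPMap.IsFormalAdjoint.le_adjoint hL fun ψ y => ?_)
    (LinearPMap.IsFormalAdjoint.le_adjoint hdense fun x y => ?_)
  · have h := (LinearPMap.adjoint_isFormalAdjoint hdense).symm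
      ⟨ψ, (LinearPMap.le_closure L).1 ψ.2⟩ y
    rwa [← (LinearPMap.le_closure L).2 (x := ψ) rfl] at h
  · have hx : ((x : H), L.closure x) ∈ L.graph.topologicalClosure := by
      rw [hcl.graph_closure_eq_closure_graph]
      exact LinearPMap.mem_graph _ x
    have h := inner_eq_of_mem_graph_of_mem_closure_graph (LinearPMap.adjoint_isFormalAdjoint hL)
      (LinearPMap.mem_graph _ y) hx
    rw [← inner_conj_symm, ← h, inner_conj_symm]

theorem adjoint_graph_le_closure_graph (hL : Dense (L.domain : Set H)) (hsymm : L ≤ L.adjoint)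
    (hpos : HasTrivialDeficiency L Complex.I) (hneg : HasTrivialDeficiency L (-Complex.I)) :
    L.adjoint.graph ≤ L.graph.topologicalClosure := by
  intro z hz
  let e := WithLp.prodContinuousLinearEquiv 2 ℂ H H
  let G : Submodule ℂ (WithLp 2 (H × H)) :=
    L.graph.topologicalClosure.comap (e.toLinearEquiv : WithLp 2 (H × H) →ₗ[ℂ] H × H)
  have hGclosed : IsClosed (G : Set (WithLp 2 (H × H))) :=
    (Submodule.isClosed_topologicalClosure _).preimage e.continuous
  have : CompleteSpace G := hGclosed.completeSpace_coe
  obtain ⟨g, hg, a, ha, hga⟩ := G.exists_add_mem_mem_orthogonal (e.symm z)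
  have hz' : z = e g + e a := by rw [← map_add, ← hga, e.apply_symm_apply]
  have hgle : L.graph.topologicalClosure ≤ L.adjoint.graph :=
    Submodule.topologicalClosure_minimal _ (LinearPMap.le_graph_of_le hsymm)
      (LinearPMap.adjoint_isClosed hL)
  have ha_adj : e a ∈ L.adjoint.graph := by
    rw [show e a = z - e g by rw [hz', add_sub_cancel_left]]
    exact sub_mem hz (hgle hg)
  have ha0 := eq_zero_of_mem_adjoint_graph_of_orthogonal hpos hneg (a := (e a).1) (b := (e a).2)
    (fun ψ => inner_eq_of_mem_graph_of_mem_closure_graph (LinearPMap.adjoint_isFormalAdjoint hL)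
      ha_adj (Submodule.le_topologicalClosure _ (LinearPMap.mem_graph L ψ)))
    (fun ψ => by
      have h : WithLp.toLp 2 ((ψ : H), L ψ) ∈ G :=
        Submodule.le_topologicalClosure _ (LinearPMap.mem_graph L ψ)
      have h' := (Submodule.mem_orthogonal' _ _).1 ha _ h
      rwa [WithLp.prod_inner_apply] at h')
  rw [hz', Prod.ext ha0.1 ha0.2 (y := 0), add_zero]
  exact hg

theorem isEssentiallySelfAdjoint_of_hasTrivialDeficiency (hL : Dense (L.domain : Set H))
    (hsymm : L.IsFormalAdjoint L) (hpos : HasTrivialDeficiency L Complex.I)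
    (hneg : HasTrivialDeficiency L (-Complex.I)) : IsEssentiallySelfAdjoint L := by
  have hle : L ≤ L.adjoint := hsymm.le_adjoint hL
  have hadj : L.adjoint.IsClosed := LinearPMap.adjoint_isClosed hL
  have hcl : L.IsClosable := hadj.isClosable.leIsClosable hle
  have hclosure : L.closure = L.adjoint := by
    refine LinearPMap.eq_of_eq_graph ?_
    rw [← hcl.graph_closure_eq_closure_graph]
    exact le_antisymm (Submodule.topologicalClosure_minimal _ (LinearPMap.le_graph_of_le hle) hadj)
      (adjoint_graph_le_closure_graph hL hle hpos hneg)
  exact ⟨hL, hcl, (adjoint_closure_eq_adjoint hL hcl).trans hclosure.symm⟩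

/-- The isometries `V t` stand for `exp (i t S)`; they turn a vector of a deficiency space into a
bounded solution of `f' = ± f`. -/
theorem isQuantumVariable_of_hasDerivAt (hD : Dense (D : Set H)) (hV0 : ∀ ψ, V 0 ψ = ψ)
    (hVinner : ∀ t ψ χ, ⟪(V t ψ : H), (V t χ : H)⟫_ℂ = ⟪(ψ : H), (χ : H)⟫_ℂ)
    (hV : ∀ t ψ, HasDerivAt (fun s => (V s ψ : H)) (Complex.I • S (V t ψ)) t) :
    IsQuantumVariable S := by
  have hVnorm : ∀ t ψ, ‖V t ψ‖ = ‖ψ‖ := fun t ψ => by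
    rw [norm_eq_sqrt_re_inner (𝕜 := ℂ), norm_eq_sqrt_re_inner (𝕜 := ℂ)]
    exact congrArg (fun z : ℂ => √z.re) (hVinner t ψ ψ)
  refine isEssentiallySelfAdjoint_of_hasTrivialDeficiency hD (fun ψ χ => ?_)
    (hasTrivialDeficiency_of_hasDerivAt hD hV0 hVnorm hV (r := -1) (by norm_num) (by simp))
    (hasTrivialDeficiency_of_hasDerivAt hD hV0 hVnorm hV (r := 1) one_ne_zero (by simp))
  have hderiv := (hV 0 ψ).inner ℂ (hV 0 χ)
  simp only [hVinner, hV0] at hderiv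
  have h := hderiv.unique (hasDerivAt_const _ _)
  rw [inner_smul_left, inner_smul_right, Complex.conj_I] at h
  refine mul_left_cancel₀ Complex.I_ne_zero ?_
  change Complex.I * ⟪S ψ, (χ : H)⟫_ℂ = Complex.I * ⟪(ψ : H), S χ⟫_ℂ
  linear_combination -h

end EssentialSelfAdjointness

section FockOperators

variable {E : Type*} [NormedAddCommGroup E] [InnerProductSpace ℂ E]

/-- The exponential vector of `g` as an element of the exponential domain. -/
def expDomainVec (g : E) : expDomain E := ⟨expVec g, Submodule.subset_span ⟨g, rfl⟩⟩

theorem expDomain_induction {p : expDomain E → Prop} (hexp : ∀ g, p (expDomainVec g))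
    (hadd : ∀ u v, p u → p v → p (u + v)) (hsmul : ∀ (c : ℂ) v, p v → p (c • v))
    (v : expDomain E) : p v := by
  obtain ⟨v, hv⟩ := v
  induction hv using Submodule.span_induction with
  | mem x hx => obtain ⟨g, rfl⟩ := hx; exact hexp g
  | zero =>
    have h := hsmul 0 _ (hexp 0)
    rw [zero_smul] at h
    exact h
  | add x y hx hy hpx hpy => exact hadd _ _ hpx hpy
  | smul c x hx hpx => exact hsmul c _ hpx

/-- The linear map on the exponential domain with prescribed values on exponential vectors. -/
def expLift {K : Type*} [AddCommGroup K] [Module ℂ K] (F : E → K) : expDomain E →ₗ[ℂ] K :=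
  Finsupp.linearCombination ℂ F ∘ₗ linearIndependent_expVec.repr

theorem expLift_expDomainVec {K : Type*} [AddCommGroup K] [Module ℂ K] (F : E → K) (g : E) :
    expLift F (expDomainVec g) = F g := by
  have hrepr : linearIndependent_expVec.repr (expDomainVec g) = Finsupp.single g 1 :=
    linearIndependent_expVec.repr_eq_single g _ rfl
  change Finsupp.linearCombination ℂ F (linearIndependent_expVec.repr (expDomainVec g)) = F g
  rw [hrepr, Finsupp.linearCombination_single, one_smul]

theorem fieldOp_expDomainVec (h g : E) :
    fieldOp h (expDomainVec g) = ⟪h, g⟫_ℂ • expVec g + fderiv ℂ expVec g h :=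
  congrArg₂ (· + ·) (expLift_expDomainVec (fun g => ⟪h, g⟫_ℂ • expVec g) g)
    (expLift_expDomainVec (fun g => fderiv ℂ expVec g h) g)

theorem dense_expDomain : Dense (expDomain E : Set (FockSpace E)) := by
  have h := RKHS.kerFun_dense (𝕜 := ℂ) (H := FockSpace E)
  rw [← Submodule.dense_iff_topologicalClosure_eq_top] at h
  refine h.mono (Submodule.span_le.2 ?_)
  rintro _ ⟨g, c, rfl⟩
  have hsmul : RKHS.kerFun (FockSpace E) g c = c • expVec g := by
    rw [expVec, ← map_smul, smul_eq_mul, mul_one]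
  rw [hsmul]
  exact Submodule.smul_mem _ c (expDomainVec g).2

theorem denseRange_expDomain_subtype : DenseRange (expDomain E).subtype := by
  simpa [DenseRange] using dense_expDomain

theorem inner_expLift {K : Type*} [NormedAddCommGroup K] [InnerProductSpace ℂ K] {F : E → K}
    (hF : ∀ f g, ⟪F f, F g⟫_ℂ = Complex.exp ⟪f, g⟫_ℂ) (u v : expDomain E) :
    ⟪expLift F u, expLift F v⟫_ℂ = ⟪u, v⟫_ℂ := by
  induction u using expDomain_induction with
  | hexp f =>
    induction v using expDomain_induction with
    | hexp g =>
      rw [expLift_expDomainVec, expLift_expDomainVec, hF]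
      exact (inner_expVec f g).symm
    | hadd u v hu hv => rw [map_add, inner_add_right, inner_add_right, hu, hv]
    | hsmul c v hv => rw [map_smul, inner_smul_right, inner_smul_right, hv]
  | hadd u v hu hv => rw [map_add, inner_add_left, inner_add_left, hu, hv]
  | hsmul c v hv => rw [map_smul, inner_smul_left, inner_smul_left, hv]

theorem norm_finsuppSum_smul_sq {ι K : Type*} [NormedAddCommGroup K] [InnerProductSpace ℂ K]
    (c : ι →₀ ℂ) (F : ι → K) : ‖c.sum fun i a => a • F i‖ ^ 2 =
      (c.sum fun i a => c.sum fun j b => conj a * ⟪F i, F j⟫_ℂ * b).re := by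
  rw [← inner_self_eq_norm_sq (𝕜 := ℂ)]
  refine congrArg Complex.re ?_
  simp only [Finsupp.sum, sum_inner, inner_sum, inner_smul_left, inner_smul_right, Finset.mul_sum]
  rw [Finset.sum_comm]
  exact Finset.sum_congr rfl fun f _ => Finset.sum_congr rfl fun g _ => by ring

theorem hasSum_powKernel (c : E →₀ ℂ) : HasSum (fun m : ℕ => ((m.factorial : ℝ))⁻¹ *
      (c.sum fun f a => c.sum fun g b => conj a * ⟪f, g⟫_ℂ ^ m * b).re)
      (c.sum fun f a => c.sum fun g b => conj a * Complex.exp ⟪f, g⟫_ℂ * b).re := by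
  simp only [Finsupp.sum, Complex.re_sum, Finset.mul_sum]
  refine hasSum_sum fun f _ => hasSum_sum fun g _ => ?_
  have hexp := NormedSpace.expSeries_div_hasSum_exp (𝔸 := ℂ) ⟪f, g⟫_ℂ
  rw [← Complex.exp_eq_exp_ℂ] at hexp
  refine (Complex.hasSum_re ((hexp.mul_left (conj (c f))).mul_right (c g))).congr_fun fun m => ?_
  rw [← Complex.re_ofReal_mul]
  congr 1
  push_cast
  ring

/-- `⟪f, g⟫` is the linear term of the exponential series of `exp ⟪f, g⟫`, all of whose terms are
positive semidefinite kernels. -/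
theorem norm_expLift_id_le (v : expDomain E) : ‖expLift (id : E → E) v‖ ≤ ‖v‖ := by
  set c := linearIndependent_expVec.repr v
  have hv : (v : FockSpace E) = c.sum fun g b => b • expVec g :=
    (linearIndependent_expVec.linearCombination_repr v).symm
  have hterm := le_hasSum (hasSum_powKernel c) 1 fun m _ =>
    mul_nonneg (by positivity) (powKernel_nonneg E c m)
  simp only [Nat.factorial_one, Nat.cast_one, inv_one, one_mul, pow_one] at hterm
  refine (sq_le_sq₀ (norm_nonneg _) (norm_nonneg _)).1 ?_
  calc ‖expLift (id : E → E) v‖ ^ 2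
      = (c.sum fun f a => c.sum fun g b => conj a * ⟪f, g⟫_ℂ * b).re :=
        norm_finsuppSum_smul_sq c id
    _ ≤ (c.sum fun f a => c.sum fun g b => conj a * Complex.exp ⟪f, g⟫_ℂ * b).re := hterm
    _ = ‖(v : FockSpace E)‖ ^ 2 := by
        rw [hv, norm_finsuppSum_smul_sq]
        simp only [inner_expVec]

theorem inner_smul_expVec_add (h f g : E) :
    ⟪Complex.exp (-((‖h‖ : ℂ) ^ 2 / 2) - ⟪h, f⟫_ℂ) • expVec (f + h),
      Complex.exp (-((‖h‖ : ℂ) ^ 2 / 2) - ⟪h, g⟫_ℂ) • expVec (g + h)⟫_ℂ =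
    Complex.exp ⟪f, g⟫_ℂ := by
  rw [inner_smul_left, inner_smul_right, inner_expVec, ← Complex.exp_conj, ← Complex.exp_add,
    ← Complex.exp_add]
  congr 1
  simp only [map_sub, map_neg, map_div₀, map_pow, Complex.conj_ofReal, inner_conj_symm,
    inner_add_left, inner_add_right, inner_self_eq_norm_sq_to_K, map_ofNat, Complex.coe_algebraMap]
  ring

/-- The displacement (Weyl) operator of `h` on the exponential domain. -/
def displacement (h : E) : expDomain E →ₗᵢ[ℂ] expDomain E :=
  (expLift fun g =>
    Complex.exp (-((‖h‖ : ℂ) ^ 2 / 2) - ⟪h, g⟫_ℂ) • expDomainVec (g + h)).isometryOfInner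
      (inner_expLift (inner_smul_expVec_add h))

theorem displacement_expDomainVec (h g : E) : displacement h (expDomainVec g) =
    Complex.exp (-((‖h‖ : ℂ) ^ 2 / 2) - ⟪h, g⟫_ℂ) • expDomainVec (g + h) :=
  expLift_expDomainVec _ g

theorem displacement_zero (v : expDomain E) : displacement (0 : E) v = v := by
  induction v using expDomain_induction with
  | hexp g => simp [displacement_expDomainVec]
  | hadd u v hu hv => rw [map_add, hu, hv]
  | hsmul c v hv => rw [map_smul, hv]

/-- The continuous extension of the displacement operator of `h` to the Fock space. -/
def displacementCLM (h : E) : FockSpace E →L[ℂ] FockSpace E :=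
  ((expDomain E).subtype ∘ₗ (displacement h).toLinearMap).extendOfNorm (expDomain E).subtype

theorem displacementCLM_expVec (h g : E) : displacementCLM h (expVec g) =
    Complex.exp (-((‖h‖ : ℂ) ^ 2 / 2) - ⟪h, g⟫_ℂ) • expVec (g + h) := by
  refine (LinearMap.extendOfNorm_eq denseRange_expDomain_subtype ⟨1, fun v => ?_⟩
    (expDomainVec g)).trans (congrArg Subtype.val (displacement_expDomainVec h g))
  rw [one_mul]
  exact ((displacement h).norm_map v).le

theorem norm_expVec_sub_expVec_zero_sq (h : E) :
    ‖expVec h - expVec (0 : E)‖ ^ 2 = Real.exp (‖h‖ ^ 2) - 1 := by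
  have hexp : (Complex.exp ((‖h‖ : ℂ) ^ 2)).re = Real.exp (‖h‖ ^ 2) := by
    rw [← Complex.ofReal_pow, ← Complex.ofReal_exp, Complex.ofReal_re]
  rw [← inner_self_eq_norm_sq (𝕜 := ℂ)]
  simp only [inner_sub_left, inner_sub_right, inner_expVec, inner_zero_left, inner_zero_right,
    Complex.exp_zero]
  simp [inner_self_eq_norm_sq_to_K, hexp]

theorem displacement_real_mul_I_smul_expDomainVec (h g : E) (t : ℝ) :
    displacement (((t : ℂ) * Complex.I) • h) (expDomainVec g) =
      Complex.exp ((t : ℂ) ^ 2 * (-(‖h‖ : ℂ) ^ 2 / 2) + t * (Complex.I * ⟪h, g⟫_ℂ)) •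
        expDomainVec (g + ((t : ℂ) * Complex.I) • h) := by
  rw [displacement_expDomainVec]
  congr 2
  rw [norm_smul, norm_mul, Complex.norm_I, mul_one, Complex.norm_real, inner_smul_left]
  simp only [map_mul, Complex.conj_ofReal, Complex.conj_I, Complex.ofReal_mul, mul_pow]
  rw [← Complex.ofReal_pow ‖t‖, Real.norm_eq_abs, sq_abs]
  push_cast
  ring

variable [CompleteSpace E]

variable (E) in
/-- The projection of the Fock space to the one-particle space, which maps `e(g)` to `g`. -/
def oneParticleProj : FockSpace E →L[ℂ] E :=
  (expLift (id : E → E)).extendOfNorm (expDomain E).subtype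

theorem oneParticleProj_expVec (g : E) : oneParticleProj E (expVec g) = g :=
  (LinearMap.extendOfNorm_eq denseRange_expDomain_subtype
    ⟨1, fun v => (norm_expLift_id_le v).trans_eq (one_mul _).symm⟩ (expDomainVec g)).trans
    (expLift_expDomainVec _ g)

theorem norm_oneParticleProj_le : ‖oneParticleProj E‖ ≤ 1 :=
  LinearMap.opNorm_extendOfNorm_le denseRange_expDomain_subtype zero_le_one
    fun v => (norm_expLift_id_le v).trans_eq (one_mul _).symm

theorem norm_expVec_sub_linear_sq_le (h : E) :
    ‖expVec h - expVec 0 - (oneParticleProj E).adjoint h‖ ^ 2 ≤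
      Real.exp (‖h‖ ^ 2) - 1 - ‖h‖ ^ 2 := by
  have hadj : ‖(oneParticleProj E).adjoint h‖ ^ 2 ≤ ‖h‖ ^ 2 := by
    refine pow_le_pow_left₀ (norm_nonneg _) ?_ 2
    have hle : ‖(oneParticleProj E).adjoint‖ ≤ 1 :=
      (LinearIsometryEquiv.norm_map _ _).trans_le norm_oneParticleProj_le
    simpa using (oneParticleProj E).adjoint.le_of_opNorm_le hle h
  have hinner : ⟪expVec h - expVec 0, (oneParticleProj E).adjoint h⟫_ℂ = ⟪h, h⟫_ℂ := by
    rw [ContinuousLinearMap.adjoint_inner_right, map_sub, oneParticleProj_expVec,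
      oneParticleProj_expVec, sub_zero]
  rw [@norm_sub_sq ℂ, hinner, norm_expVec_sub_expVec_zero_sq, inner_self_eq_norm_sq]
  linarith

theorem hasFDerivAt_expVec_zero :
    HasFDerivAt (expVec : E → FockSpace E) (oneParticleProj E).adjoint 0 := by
  set D := (oneParticleProj E).adjoint
  have hbigO : (fun h : E => expVec h - expVec 0 - D h) =O[nhds 0] fun h => ‖h - 0‖ ^ 2 := by
    refine Asymptotics.IsBigO.of_bound 1 ?_
    filter_upwards [Metric.ball_mem_nhds (0 : E) one_pos] with h hh
    have hsq : |‖h‖ ^ 2| ≤ 1 := by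
      rw [abs_of_nonneg (by positivity)]
      exact pow_le_one₀ (norm_nonneg h) (mem_ball_zero_iff.1 hh).le
    rw [one_mul, sub_zero, norm_pow, norm_norm]
    refine (sq_le_sq₀ (norm_nonneg _) (by positivity)).1 ?_
    calc _ ≤ Real.exp (‖h‖ ^ 2) - 1 - ‖h‖ ^ 2 := norm_expVec_sub_linear_sq_le h
      _ ≤ (‖h‖ ^ 2) ^ 2 := (le_abs_self _).trans (Real.abs_exp_sub_one_sub_id_le hsq)
  have h := ((hbigO.hasFDerivAt one_lt_two).add D.hasFDerivAt).add_const (expVec 0)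
  rw [zero_add] at h
  exact h.congr_of_eventuallyEq (Filter.Eventually.of_forall fun h => by simp)

theorem differentiable_expVec : Differentiable ℂ (expVec : E → FockSpace E) := by
  intro g
  have hshift : (expVec : E → FockSpace E) = fun h =>
      Complex.exp ((‖g‖ : ℂ) ^ 2 / 2 + ⟪g, h - g⟫_ℂ) • displacementCLM g (expVec (h - g)) := by
    ext1 h
    rw [displacementCLM_expVec, smul_smul, ← Complex.exp_add, sub_add_cancel]
    simp
  have hzero : DifferentiableAt ℂ (expVec : E → FockSpace E) (g - g) := by
    rw [sub_self]
    exact hasFDerivAt_expVec_zero.differentiableAt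
  have hexp : DifferentiableAt ℂ (fun h => expVec (h - g)) g :=
    DifferentiableAt.comp (f := fun h : E => h - g) g hzero (by fun_prop)
  have hinner : DifferentiableAt ℂ (fun h : E => ⟪g, h - g⟫_ℂ) g := by
    simp only [← innerSL_apply_apply ℂ]
    fun_prop
  rw [hshift]
  fun_prop

theorem hasDerivAt_displacement_expDomainVec (h g : E) (t : ℝ) :
    HasDerivAt (fun s : ℝ => (displacement (((s : ℂ) * Complex.I) • h) (expDomainVec g) :
      FockSpace E))
      (Complex.I • fieldOp h (displacement (((t : ℂ) * Complex.I) • h) (expDomainVec g))) t := by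
  simp only [displacement_real_mul_I_smul_expDomainVec, map_smul, fieldOp_expDomainVec]
  set a : ℂ := -(‖h‖ : ℂ) ^ 2 / 2
  set c : ℂ := Complex.I * ⟪h, g⟫_ℂ
  have hphase : HasDerivAt (fun s : ℝ => Complex.exp ((s : ℂ) ^ 2 * a + s * c))
      (Complex.exp ((t : ℂ) ^ 2 * a + t * c) * (2 * t * a + c)) t := by
    have h := ((((hasDerivAt_id (t : ℂ)).pow 2).mul_const a).add
      ((hasDerivAt_id (t : ℂ)).mul_const c)).cexp.comp_ofReal
    simpa using h
  have hline : HasDerivAt (fun s : ℝ => g + ((s : ℂ) * Complex.I) • h) (Complex.I • h) t := by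
    have h := ((Complex.ofRealCLM.hasDerivAt (x := t)).mul_const Complex.I).smul_const h
    simpa using h.const_add g
  have hexp := (differentiable_expVec _).hasFDerivAt.restrictScalars ℝ |>.comp_hasDerivAt t hline
  refine (hphase.smul hexp).congr_deriv ?_
  rw [Function.comp_apply, ContinuousLinearMap.coe_restrictScalars', map_smul, inner_add_right,
    inner_smul_right, inner_self_eq_norm_sq_to_K, add_comm]
  simp only [smul_add, smul_smul, a, c]
  congr 2
  · linear_combination (-Complex.exp ((t : ℂ) ^ 2 * a + t * c) * t * (‖h‖ : ℂ) ^ 2) * Complex.I_sq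
  · ring

theorem hasDerivAt_displacement (h : E) (v : expDomain E) (t : ℝ) :
    HasDerivAt (fun s : ℝ => (displacement (((s : ℂ) * Complex.I) • h) v : FockSpace E))
      (Complex.I • fieldOp h (displacement (((t : ℂ) * Complex.I) • h) v)) t := by
  induction v using expDomain_induction with
  | hexp g => exact hasDerivAt_displacement_expDomainVec h g t
  | hadd u v hu hv =>
    simp only [map_add, Submodule.coe_add, smul_add]
    exact hu.add hv
  | hsmul c v hv =>
    simp only [map_smul, Submodule.coe_smul]
    rw [smul_comm]
    exact hv.const_smul c

end FockOperators

section WeylSystem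

variable {H : Type*} [NormedAddCommGroup H] [InnerProductSpace ℂ H]

theorem hasDerivAt_clm_apply_zero {V : ℝ → H →L[ℂ] H} (hV0 : V 0 = 1) (hV : ∀ t ψ, ‖V t ψ‖ ≤ ‖ψ‖)
    (hVcont : ∀ ψ, Continuous fun t => V t ψ) {y : ℝ → H} {v w : H}
    (hVy : HasDerivAt (fun t => V t (y 0)) v 0) (hy : HasDerivAt y w 0) :
    HasDerivAt (fun t => V t (y t)) (v + w) 0 := by
  have hlin : HasDerivAt (fun t : ℝ => t • V t w) w 0 := by
    have hlim : (fun t : ℝ => V t w - w) =o[nhds 0] fun _ : ℝ => (1 : ℝ) := by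
      rw [Asymptotics.isLittleO_one_iff]
      have hcont : Continuous fun t => V t w - w := (hVcont w).sub continuous_const
      simpa [hV0] using hcont.tendsto 0
    rw [hasDerivAt_iff_isLittleO_nhds_zero]
    simp only [zero_add, zero_smul, sub_zero, ← smul_sub]
    simpa using (Asymptotics.isBigO_refl (fun t : ℝ => t) (nhds 0)).smul_isLittleO hlim
  have hrem : HasDerivAt (fun t : ℝ => V t (y t - y 0 - t • w)) 0 0 := by
    rw [hasDerivAt_iff_isLittleO_nhds_zero] at hy ⊢
    simp only [zero_add, sub_self, zero_smul, map_zero, smul_zero, sub_zero] at hy ⊢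
    refine Asymptotics.IsBigO.trans_isLittleO (Asymptotics.IsBigO.of_bound 1 ?_) hy
    exact Filter.Eventually.of_forall fun t => (hV t _).trans_eq (one_mul _).symm
  have hsum := (hVy.add hlin).add hrem
  rw [add_zero] at hsum
  refine hsum.congr_of_eventuallyEq (Filter.Eventually.of_forall fun t => ?_)
  change V t (y t) = V t (y 0) + t • V t w + V t (y t - y 0 - t • w)
  rw [← ContinuousLinearMap.map_smul_of_tower, ← map_add, ← map_add]
  congr 1
  abel

theorem hasDerivAt_comp_smul_smul {F : Type*} [AddCommGroup F] [Module ℝ F] {f : F → H} {a : F}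
    {f' : H} (hf : HasDerivAt (fun t : ℝ => f (t • a)) f' 0) (c : ℝ) :
    HasDerivAt (fun t : ℝ => f (t • c • a)) (c • f') 0 := by
  rw [← zero_mul c] at hf
  simpa [Function.comp_def, smul_smul] using
    HasDerivAt.scomp (0 : ℝ) hf ((hasDerivAt_id (0 : ℝ)).mul_const c)

theorem dotProduct_mulVec_skew {n : ℕ} {Θ : Matrix (Fin n) (Fin n) ℝ} (hΘ : Θᵀ = -Θ)
    (u v : Fin n → ℝ) : v ⬝ᵥ Θ *ᵥ u = -(u ⬝ᵥ Θ *ᵥ v) := by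
  rw [Matrix.dotProduct_mulVec, ← Matrix.mulVec_transpose, hΘ, Matrix.neg_mulVec, neg_dotProduct,
    dotProduct_comm]

theorem dotProduct_mulVec_self_skew {n : ℕ} {Θ : Matrix (Fin n) (Fin n) ℝ} (hΘ : Θᵀ = -Θ)
    (u : Fin n → ℝ) : u ⬝ᵥ Θ *ᵥ u = 0 :=
  self_eq_neg.1 (dotProduct_mulVec_skew hΘ u u)

variable [CompleteSpace H] {n : ℕ} {Θ : Matrix (Fin n) (Fin n) ℝ} {U : (Fin n → ℝ) → H →L[ℂ] H}

/-- A strongly continuous unitary representation `U` of the Weyl relations with commutation matrix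
`Θ`; the operator `exp (i uᵀ X₀)` of the paper is `U u`. -/
structure IsWeylSystem (Θ : Matrix (Fin n) (Fin n) ℝ) (U : (Fin n → ℝ) → H →L[ℂ] H) : Prop where
  unitary : ∀ u, U u ∈ unitary (H →L[ℂ] H)
  continuous : ∀ ψ, Continuous fun u => U u ψ
  mul : ∀ u v, U u * U v = Complex.exp (-Complex.I * ((u ⬝ᵥ Θ *ᵥ v : ℝ) : ℂ)) • U (u + v)

namespace IsWeylSystem

theorem norm_map (hU : IsWeylSystem Θ U) (u : Fin n → ℝ) (ψ : H) : ‖U u ψ‖ = ‖ψ‖ :=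
  ContinuousLinearMap.norm_map_of_mem_unitary (hU.unitary u) ψ

theorem map_zero (hU : IsWeylSystem Θ U) : U 0 = 1 := by
  have hmul : U 0 * U 0 = U 0 := by simpa using hU.mul 0 0
  have hstar := (Unitary.mem_iff.1 (hU.unitary 0)).1
  calc U 0 = star (U 0) * U 0 * U 0 := by rw [hstar, one_mul]
    _ = 1 := by rw [mul_assoc, hmul, hstar]

theorem map_add (hU : IsWeylSystem Θ U) (u v : Fin n → ℝ) (ψ : H) :
    U (u + v) ψ = Complex.exp (Complex.I * ((u ⬝ᵥ Θ *ᵥ v : ℝ) : ℂ)) • U u (U v ψ) := by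
  rw [← mul_apply_eq_comp, hU.mul, smul_apply, smul_smul, ← Complex.exp_add]
  simp

theorem map_comm (hU : IsWeylSystem Θ U) (hΘ : Θᵀ = -Θ) (u v : Fin n → ℝ) (ψ : H) :
    U u (U v ψ) = Complex.exp (-2 * Complex.I * ((u ⬝ᵥ Θ *ᵥ v : ℝ) : ℂ)) • U v (U u ψ) := by
  have hmul (u v : Fin n → ℝ) : U u (U v ψ) =
      Complex.exp (-Complex.I * ((u ⬝ᵥ Θ *ᵥ v : ℝ) : ℂ)) • U (u + v) ψ := by
    rw [← mul_apply_eq_comp, hU.mul, smul_apply]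
  rw [hmul u v, hmul v u, dotProduct_mulVec_skew hΘ u v, smul_smul, ← Complex.exp_add, add_comm v]
  congr 2
  push_cast
  ring

theorem map_smul_add (hU : IsWeylSystem Θ U) (hΘ : Θᵀ = -Θ) (a : Fin n → ℝ) (s t : ℝ) (ψ : H) :
    U ((s + t) • a) ψ = U (s • a) (U (t • a) ψ) := by
  rw [add_smul, hU.map_add, smul_dotProduct, Matrix.mulVec_smul, dotProduct_smul,
    dotProduct_mulVec_self_skew hΘ]
  simp

theorem continuous_smul (hU : IsWeylSystem Θ U) (a : Fin n → ℝ) (ψ : H) :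
    Continuous fun t : ℝ => U (t • a) ψ :=
  (hU.continuous ψ).comp (by fun_prop)

theorem differentiableAt_map (hU : IsWeylSystem Θ U) (hΘ : Θᵀ = -Θ) {a : Fin n → ℝ} {ψ : H}
    (hψ : DifferentiableAt ℝ (fun t : ℝ => U (t • a) ψ) 0) (v : Fin n → ℝ) :
    DifferentiableAt ℝ (fun t : ℝ => U (t • a) (U v ψ)) 0 := by
  simp only [hU.map_comm hΘ _ v, smul_dotProduct, smul_eq_mul]
  have hmap : DifferentiableAt ℝ (fun t : ℝ => U v (U (t • a) ψ)) 0 :=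
    ((U v).restrictScalars ℝ).differentiableAt.comp (0 : ℝ) hψ
  have hphase : DifferentiableAt ℝ (fun t : ℝ =>
      Complex.exp (-2 * Complex.I * ((t * (a ⬝ᵥ Θ *ᵥ v) : ℝ) : ℂ))) 0 := by
    push_cast
    fun_prop
  exact hphase.smul hmap

theorem hasDerivAt_of_zero (hU : IsWeylSystem Θ U) (hΘ : Θᵀ = -Θ) {a : Fin n → ℝ} {ψ ψ' : H}
    {t : ℝ} (hψ : HasDerivAt (fun s : ℝ => U (s • a) (U (t • a) ψ)) ψ' 0) :
    HasDerivAt (fun s : ℝ => U (s • a) ψ) ψ' t := by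
  rw [← sub_self t] at hψ
  refine (hψ.comp_sub_const t t).congr_of_eventuallyEq (Filter.Eventually.of_forall fun s => ?_)
  change U (s • a) ψ = U ((s - t) • a) (U (t • a) ψ)
  rw [← hU.map_smul_add hΘ, sub_add_cancel]

theorem hasDerivAt_map_smul (hU : IsWeylSystem Θ U) (hΘ : Θᵀ = -Θ) {a : Fin n → ℝ} {ψ ψ' : H}
    (hψ : HasDerivAt (fun t : ℝ => U (t • a) ψ) ψ' 0) (t : ℝ) :
    HasDerivAt (fun t : ℝ => U (t • a) ψ) (U (t • a) ψ') t := by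
  refine hU.hasDerivAt_of_zero hΘ ?_
  simp only [← hU.map_smul_add hΘ, add_comm _ t]
  simp only [hU.map_smul_add hΘ]
  exact ((U (t • a)).restrictScalars ℝ).hasFDerivAt.comp_hasDerivAt (0 : ℝ) hψ

theorem hasDerivAt_add (hU : IsWeylSystem Θ U) {a b : Fin n → ℝ} {ψ ψa ψb : H}
    (ha : HasDerivAt (fun t : ℝ => U (t • a) ψ) ψa 0)
    (hb : HasDerivAt (fun t : ℝ => U (t • b) ψ) ψb 0) :
    HasDerivAt (fun t : ℝ => U (t • (a + b)) ψ) (ψa + ψb) 0 := by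
  simp only [smul_add, hU.map_add, smul_dotProduct, Matrix.mulVec_smul, dotProduct_smul]
  have hmap := hasDerivAt_clm_apply_zero (V := fun t : ℝ => U (t • a))
    (y := fun t : ℝ => U (t • b) ψ) (by simp [hU.map_zero]) (fun t ψ => (hU.norm_map _ _).le)
    (hU.continuous_smul a) (by simpa [hU.map_zero] using ha) hb
  have hphase : HasDerivAt (fun t : ℝ =>
      Complex.exp (Complex.I * ((t • t • (a ⬝ᵥ Θ *ᵥ b) : ℝ) : ℂ))) 0 0 := by
    have h := ((((hasDerivAt_id ((0 : ℝ) : ℂ)).mul ((hasDerivAt_id ((0 : ℝ) : ℂ)).mul_const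
      ((a ⬝ᵥ Θ *ᵥ b : ℝ) : ℂ))).const_mul Complex.I).cexp).comp_ofReal
    simpa using h
  exact (hphase.smul hmap).congr_deriv (by simp)

theorem hasDerivAt_sum (hU : IsWeylSystem Θ U) (a : Fin n → ℝ) {ψ : H} {ψ' : Fin n → H}
    (hψ : ∀ j, HasDerivAt (fun t : ℝ => U (t • Pi.single j 1) ψ) (ψ' j) 0) :
    HasDerivAt (fun t : ℝ => U (t • a) ψ) (∑ j, a j • ψ' j) 0 := by
  have hpartial (s : Finset (Fin n)) : HasDerivAt
      (fun t : ℝ => U (t • ∑ j ∈ s, a j • Pi.single j 1) ψ) (∑ j ∈ s, a j • ψ' j) 0 := by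
    induction s using Finset.induction_on with
    | empty => simpa using hasDerivAt_const (0 : ℝ) (U 0 ψ)
    | insert j s hj ih =>
      simp only [Finset.sum_insert hj]
      exact hU.hasDerivAt_add (hasDerivAt_comp_smul_smul (f := (U · ψ)) (hψ j) (a j)) ih
  simpa only [← pi_eq_sum_univ'] using hpartial Finset.univ

theorem map_integral (hU : IsWeylSystem Θ U) (u b : Fin n → ℝ) (ψ : H) (δ : ℝ) :
    U u (∫ r in (0 : ℝ)..δ, U (r • b) ψ) = ∫ r in (0 : ℝ)..δ, U u (U (r • b) ψ) :=
  ((U u).intervalIntegral_comp_comm ((hU.continuous_smul b ψ).intervalIntegrable _ _)).symm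

theorem hasDerivAt_integral (hU : IsWeylSystem Θ U) (a : Fin n → ℝ) (ψ : H) (x : ℝ) :
    HasDerivAt (fun x => ∫ r in (0 : ℝ)..x, U (r • a) ψ) (U (x • a) ψ) x :=
  (hU.continuous_smul a ψ).integral_hasStrictDerivAt 0 x |>.hasDerivAt

theorem differentiableAt_map_integral_self (hU : IsWeylSystem Θ U) (hΘ : Θᵀ = -Θ)
    (a : Fin n → ℝ) (ψ : H) (δ : ℝ) :
    DifferentiableAt ℝ (fun t : ℝ => U (t • a) (∫ r in (0 : ℝ)..δ, U (r • a) ψ)) 0 := by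
  have hint (x y : ℝ) := (hU.continuous_smul a ψ).intervalIntegrable (μ := MeasureTheory.volume) x y
  have hshift (t : ℝ) : U (t • a) (∫ r in (0 : ℝ)..δ, U (r • a) ψ) =
      (∫ r in (0 : ℝ)..(t + δ), U (r • a) ψ) - ∫ r in (0 : ℝ)..t, U (r • a) ψ := by
    rw [hU.map_integral]
    simp only [← hU.map_smul_add hΘ]
    rw [intervalIntegral.integral_comp_add_left (fun r => U (r • a) ψ), add_zero,
      intervalIntegral.integral_interval_sub_left (hint _ _) (hint _ _)]
  simp only [hshift]
  exact (((hU.hasDerivAt_integral a ψ _).comp_add_const 0 δ).sub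
    (hU.hasDerivAt_integral a ψ 0)).differentiableAt

theorem differentiableAt_map_integral (hU : IsWeylSystem Θ U) (hΘ : Θᵀ = -Θ)
    {a : Fin n → ℝ} {ψ : H} (hψ : DifferentiableAt ℝ (fun t : ℝ => U (t • a) ψ) 0)
    (b : Fin n → ℝ) (δ : ℝ) :
    DifferentiableAt ℝ (fun t : ℝ => U (t • a) (∫ r in (0 : ℝ)..δ, U (r • b) ψ)) 0 := by
  let c : ℝ := a ⬝ᵥ Θ *ᵥ b
  let ψ' : H := deriv (fun t : ℝ => U (t • a) ψ) 0
  let phase (t r : ℝ) : ℂ := Complex.exp (-2 * Complex.I * ((t * (r * c) : ℝ) : ℂ))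
  have hphase (t r : ℝ) : HasDerivAt (fun t => phase t r)
      (phase t r * (-2 * Complex.I * (r * c))) t := by
    have h := (((hasDerivAt_id (t : ℂ)).mul_const ((r * c : ℝ) : ℂ)).const_mul
      (-2 * Complex.I)).cexp.comp_ofReal
    simpa [phase] using h
  have hnorm (t r : ℝ) : ‖phase t r‖ = 1 := by simp [phase, Complex.norm_exp]
  have hcont (t : ℝ) : Continuous (phase t) := by
    simp only [phase]
    fun_prop
  have hcomm (t : ℝ) : U (t • a) (∫ r in (0 : ℝ)..δ, U (r • b) ψ) =
      ∫ r in (0 : ℝ)..δ, phase t r • U (r • b) (U (t • a) ψ) := by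
    rw [hU.map_integral]
    simp only [hU.map_comm hΘ (t • a), smul_dotProduct, Matrix.mulVec_smul, dotProduct_smul,
      smul_eq_mul, mul_left_comm _ t]
    rfl
  simp only [hcomm]
  refine (intervalIntegral.hasDerivAt_integral_of_dominated_loc_of_deriv_le
    (F' := fun t r => phase t r • U (r • b) (U (t • a) ψ') +
      (phase t r * (-2 * Complex.I * (r * c))) • U (r • b) (U (t • a) ψ))
    (bound := fun r => ‖ψ'‖ + 2 * |r * c| * ‖ψ‖) (Metric.ball_mem_nhds (0 : ℝ) one_pos)
    (Filter.Eventually.of_forall fun t =>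
      ((hcont t).smul (hU.continuous_smul b _)).aestronglyMeasurable)
    (((hcont 0).smul (hU.continuous_smul b _)).intervalIntegrable _ _)
    (((hcont 0).smul (hU.continuous_smul b _)).add
      (((hcont 0).mul (by fun_prop)).smul (hU.continuous_smul b _))).aestronglyMeasurable
    (Filter.Eventually.of_forall fun r _ t _ => ?_)
    (Continuous.intervalIntegrable (by fun_prop) _ _)
    (Filter.Eventually.of_forall fun r _ t _ => (hphase t r).smul
      (((U (r • b)).restrictScalars ℝ).hasFDerivAt.comp_hasDerivAt t
        (hU.hasDerivAt_map_smul hΘ hψ.hasDerivAt t)))).2.differentiableAt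
  refine (norm_add_le _ _).trans_eq ?_
  simp [norm_smul, hnorm, hU.norm_map, abs_mul]

theorem tendsto_average (hU : IsWeylSystem Θ U) (a : Fin n → ℝ) (ψ : H) :
    Filter.Tendsto (fun δ : ℝ => δ⁻¹ • ∫ r in (0 : ℝ)..δ, U (r • a) ψ) (nhdsWithin 0 {0}ᶜ)
      (nhds ψ) := by
  simpa [hU.map_zero] using (hU.hasDerivAt_integral a ψ 0).tendsto_slope_zero

/-- Averaging over a short time along one more direction makes a vector differentiable in that
direction and preserves differentiability in the previous ones. -/
theorem exists_dist_lt_differentiableAt {ι : Type*} (hU : IsWeylSystem Θ U) (hΘ : Θᵀ = -Θ)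
    (e : ι → Fin n → ℝ) (s : Finset ι) (ψ : H) {ε : ℝ} (hε : 0 < ε) :
    ∃ χ : H, dist χ ψ < ε ∧ ∀ k ∈ s, DifferentiableAt ℝ (fun t : ℝ => U (t • e k) χ) 0 := by
  classical
  induction s using Finset.induction_on generalizing ε with
  | empty => exact ⟨ψ, by simpa using hε, by simp⟩
  | insert j s hj ih =>
    obtain ⟨χ, hχ, hχs⟩ := ih (half_pos hε)
    obtain ⟨δ, hδ⟩ := ((hU.tendsto_average (e j) χ).eventually
      (Metric.ball_mem_nhds χ (half_pos hε))).exists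
    refine ⟨δ⁻¹ • ∫ r in (0 : ℝ)..δ, U (r • e j) χ,
      (dist_triangle _ _ _).trans_lt ((add_lt_add hδ hχ).trans_eq (add_halves ε)), fun k hk => ?_⟩
    simp only [ContinuousLinearMap.map_smul_of_tower]
    refine DifferentiableAt.const_smul ?_ _
    rcases Finset.mem_insert.1 hk with rfl | hks
    · exact hU.differentiableAt_map_integral_self hΘ _ χ δ
    · exact hU.differentiableAt_map_integral hΘ (hχs k hks) _ δ

end IsWeylSystem

end WeylSystem

section InitialVariables

variable {H : Type*} [NormedAddCommGroup H] [InnerProductSpace ℂ H] {n : ℕ}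
  {X₀ : Fin n → H →ₗ.[ℂ] H} {Θ : Matrix (Fin n) (Fin n) ℝ}

/-- The linear combination `∑ aⱼ X₀ⱼ` of the initial variables on their common domain. -/
def initialComb (X₀ : Fin n → H →ₗ.[ℂ] H) (a : Fin n → ℝ) : initialDomain X₀ →ₗ[ℂ] H :=
  ∑ j, (a j : ℂ) • ((X₀ j).toFun ∘ₗ Submodule.inclusion (iInf_le _ j))

theorem hasDerivAt_stoneGenerator {S : H →ₗ.[ℂ] H} {V : ℝ → H →L[ℂ] H} (h : S = stoneGenerator V)
    {ψ : H} (hψ : ψ ∈ S.domain) : HasDerivAt (fun t => V t ψ) (Complex.I • S ⟨ψ, hψ⟩) 0 := by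
  subst h
  have hdiff : DifferentiableAt ℝ (fun t => V t ψ) 0 := hψ
  refine hdiff.hasDerivAt.congr_deriv ?_
  change _ = Complex.I • (-Complex.I • deriv (fun t => V t ψ) 0)
  simp [smul_smul]

theorem mem_initialDomain_iff {U : (Fin n → ℝ) → H →L[ℂ] H}
    (hX₀ : ∀ j, X₀ j = stoneGenerator fun t => U (Pi.single j t)) (ψ : H) :
    ψ ∈ initialDomain X₀ ↔
      ∀ j, DifferentiableAt ℝ (fun t : ℝ => U (t • (Pi.single j 1 : Fin n → ℝ)) ψ) 0 := by
  simp only [initialDomain, Submodule.mem_iInf, ← Pi.single_smul, smul_eq_mul, mul_one, hX₀]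
  rfl

variable [CompleteSpace H]

theorem dense_initialDomain (hΘ : Θᵀ = -Θ) (hX₀ : SatisfiesWeylCCR Θ X₀) :
    Dense (initialDomain X₀ : Set H) := by
  obtain ⟨U, hunitary, hcont, hmul, hgen⟩ := hX₀
  have hU : IsWeylSystem Θ U := ⟨hunitary, hcont, hmul⟩
  refine Metric.dense_iff.2 fun ψ r hr => ?_
  obtain ⟨χ, hχ, hdiff⟩ :=
    hU.exists_dist_lt_differentiableAt hΘ (fun j => Pi.single j 1) Finset.univ ψ hr
  exact ⟨χ, hχ, (mem_initialDomain_iff hgen χ).2 fun j => hdiff j (Finset.mem_univ j)⟩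

theorem exists_hasDerivAt_initialComb (hΘ : Θᵀ = -Θ) (hX₀ : SatisfiesWeylCCR Θ X₀)
    (a : Fin n → ℝ) : ∃ V : ℝ → initialDomain X₀ →ₗᵢ[ℂ] initialDomain X₀, (∀ ψ, V 0 ψ = ψ) ∧
      ∀ t ψ, HasDerivAt (fun s => (V s ψ : H)) (Complex.I • initialComb X₀ a (V t ψ)) t := by
  obtain ⟨U, hunitary, hcont, hmul, hgen⟩ := hX₀
  have hU : IsWeylSystem Θ U := ⟨hunitary, hcont, hmul⟩
  have hinv : ∀ v, ∀ ψ ∈ initialDomain X₀, U v ψ ∈ initialDomain X₀ := fun v ψ hψ =>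
    (mem_initialDomain_iff hgen _).2 fun j =>
      hU.differentiableAt_map hΘ ((mem_initialDomain_iff hgen ψ).1 hψ j) v
  refine ⟨fun t => ⟨(U (t • a)).toLinearMap.restrict (hinv (t • a)), fun ψ => hU.norm_map _ _⟩,
    fun ψ => Subtype.ext ?_, fun t ψ => hU.hasDerivAt_of_zero hΘ ?_⟩
  · change U ((0 : ℝ) • a) (ψ : H) = ψ
    rw [zero_smul, hU.map_zero, one_apply_eq_self]
  · have hmem (j : Fin n) : U (t • a) ψ ∈ (X₀ j).domain :=
      (Submodule.mem_iInf _).1 (hinv (t • a) ψ ψ.2) j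
    have hcoord (j : Fin n) : HasDerivAt (fun s : ℝ => U (s • Pi.single j 1) (U (t • a) ψ))
        (Complex.I • X₀ j ⟨U (t • a) ψ, hmem j⟩) 0 := by
      simpa only [← Pi.single_smul, smul_eq_mul, mul_one] using
        hasDerivAt_stoneGenerator (hgen j) (hmem j)
    refine (hU.hasDerivAt_sum a hcoord).congr_deriv ?_
    simp only [initialComb, LinearMap.sum_apply, Finset.smul_sum]
    refine Finset.sum_congr rfl fun j _ => ?_
    rw [smul_comm]
    rfl

end InitialVariables

section TensorDomain

variable {H₀ : Type*} [NormedAddCommGroup H₀] [InnerProductSpace ℂ H₀]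
  {E : Type*} [NormedAddCommGroup E] [InnerProductSpace ℂ E] {P : Submodule ℂ H₀}

theorem inner_tensorDomainEquiv (x y : P ⊗[ℂ] expDomain E) :
    ⟪(tensorDomainEquiv E P x : SystemFieldSpace H₀ E), tensorDomainEquiv E P y⟫_ℂ = ⟪x, y⟫_ℂ :=
  (UniformSpace.Completion.inner_coe _ _).trans (TensorProduct.inner_mapIncl_mapIncl P _ x y)

variable (H₀ E) in
/-- The embedding of the algebraic tensor product as a continuous linear map. -/
def toSystemFieldL : H₀ ⊗[ℂ] FockSpace E →L[ℂ] SystemFieldSpace H₀ E :=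
  UniformSpace.Completion.toComplL

theorem toSystemField_tmul_mem_closure_tensorDomain (hP : Dense (P : Set H₀)) (u : H₀)
    (v : FockSpace E) : toSystemField H₀ E (u ⊗ₜ v) ∈ (tensorDomain E P).topologicalClosure := by
  have hcont : Continuous fun z : H₀ × FockSpace E => toSystemField H₀ E (z.1 ⊗ₜ z.2) :=
    (toSystemFieldL H₀ E).continuous.comp TensorProduct.continuous_tmul
  have hmaps : Set.MapsTo (fun z : H₀ × FockSpace E => toSystemField H₀ E (z.1 ⊗ₜ z.2))
      ((P : Set H₀) ×ˢ (expDomain E : Set (FockSpace E)))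
      (tensorDomain E P : Set (SystemFieldSpace H₀ E)) := by
    rintro ⟨x, y⟩ ⟨hx, hy⟩
    exact ⟨(⟨x, hx⟩ : P) ⊗ₜ (⟨y, hy⟩ : expDomain E), rfl⟩
  exact hmaps.closure hcont (hP.prod dense_expDomain (u, v))

theorem dense_tensorDomain (hP : Dense (P : Set H₀)) :
    Dense (tensorDomain E P : Set (SystemFieldSpace H₀ E)) := by
  have hrange : Set.range ((↑) : H₀ ⊗[ℂ] FockSpace E → SystemFieldSpace H₀ E) ⊆
      (tensorDomain E P).topologicalClosure := by
    rintro _ ⟨x, rfl⟩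
    change toSystemField H₀ E x ∈ (tensorDomain E P).topologicalClosure
    induction x using TensorProduct.induction_on with
    | zero => rw [map_zero]; exact Submodule.zero_mem _
    | tmul u v => exact toSystemField_tmul_mem_closure_tensorDomain hP u v
    | add x y hx hy => rw [map_add]; exact Submodule.add_mem _ hx hy
  exact fun z => closure_minimal hrange (Submodule.isClosed_topologicalClosure _)
    (UniformSpace.Completion.denseRange_coe z)

theorem systemAmpl_tensorDomainEquiv (S : P →ₗ[ℂ] H₀) (x : P ⊗[ℂ] expDomain E) :
    systemAmpl S (tensorDomainEquiv E P x) =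
      toSystemField H₀ E (TensorProduct.map S (expDomain E).subtype x) := by
  simp [systemAmpl]

theorem fieldAmpl_tensorDomainEquiv (S : expDomain E →ₗ[ℂ] FockSpace E) (x : P ⊗[ℂ] expDomain E) :
    fieldAmpl P S (tensorDomainEquiv E P x) =
      toSystemField H₀ E (TensorProduct.map P.subtype S x) := by
  simp [fieldAmpl]

theorem hasDerivAt_toSystemField_tmul {f : ℝ → H₀} {g : ℝ → FockSpace E} {f' : H₀}
    {g' : FockSpace E} {t : ℝ} (hf : HasDerivAt f f' t) (hg : HasDerivAt g g' t) :
    HasDerivAt (fun s => toSystemField H₀ E (f s ⊗ₜ g s))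
      (toSystemField H₀ E (f' ⊗ₜ g t + f t ⊗ₜ g')) t := by
  let B := ContinuousLinearMap.bilinearRestrictScalars ℝ (TensorProduct.mkL ℂ H₀ (FockSpace E))
  rw [add_comm]
  exact ((toSystemFieldL H₀ E).restrictScalars ℝ).hasFDerivAt.comp_hasDerivAt t
    (B.hasDerivAt_of_bilinear (fun _ => hf) (fun _ => hg))

theorem hasDerivAt_tensorDomainEquiv_map {S : P →ₗ[ℂ] H₀} {V : ℝ → P →ₗ[ℂ] P}
    {L : expDomain E →ₗ[ℂ] FockSpace E} {W : ℝ → expDomain E →ₗ[ℂ] expDomain E} {t : ℝ}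
    (hV : ∀ u, HasDerivAt (fun s => (V s u : H₀)) (Complex.I • S (V t u)) t)
    (hW : ∀ v, HasDerivAt (fun s => (W s v : FockSpace E)) (Complex.I • L (W t v)) t)
    (x : P ⊗[ℂ] expDomain E) :
    HasDerivAt (fun s => (tensorDomainEquiv E P (TensorProduct.map (V s) (W s) x) :
        SystemFieldSpace H₀ E))
      (Complex.I • (systemAmpl S + fieldAmpl P L : tensorDomain E P →ₗ[ℂ] SystemFieldSpace H₀ E)
        (tensorDomainEquiv E P (TensorProduct.map (V t) (W t) x))) t := by
  rw [LinearMap.add_apply, systemAmpl_tensorDomainEquiv, fieldAmpl_tensorDomainEquiv]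
  change HasDerivAt (fun s => toSystemField H₀ E
    (TensorProduct.mapIncl P (expDomain E) (TensorProduct.map (V s) (W s) x))) _ t
  induction x using TensorProduct.induction_on with
  | zero =>
    simp only [map_zero, add_zero, smul_zero]
    exact hasDerivAt_const _ _
  | add x y hx hy =>
    simp only [map_add, smul_add] at hx hy ⊢
    refine (hx.add hy).congr_deriv ?_
    abel
  | tmul u v =>
    refine (hasDerivAt_toSystemField_tmul (hV u) (hW v)).congr_deriv ?_
    rw [TensorProduct.tmul_smul, ← TensorProduct.smul_tmul', ← smul_add, map_smul, map_add]
    rfl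

variable [CompleteSpace E]

theorem isQuantumVariable_systemAmpl_add_fieldAmpl (hP : Dense (P : Set H₀)) {S : P →ₗ[ℂ] H₀}
    {V : ℝ → P →ₗᵢ[ℂ] P} (hV0 : ∀ ψ, V 0 ψ = ψ)
    (hV : ∀ t ψ, HasDerivAt (fun s => (V s ψ : H₀)) (Complex.I • S (V t ψ)) t) (h : E) :
    IsQuantumVariable (systemAmpl S + fieldAmpl P (fieldOp h)) := by
  let W (t : ℝ) : expDomain E →ₗᵢ[ℂ] expDomain E := displacement (((t : ℂ) * Complex.I) • h)
  let e := tensorDomainEquiv E P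
  refine isQuantumVariable_of_hasDerivAt (dense_tensorDomain hP) (V := fun t ψ =>
    e (TensorProduct.map (V t).toLinearMap (W t).toLinearMap (e.symm ψ))) ?_ ?_ ?_
  · intro ψ
    have hV0' : (V 0).toLinearMap = LinearMap.id := LinearMap.ext hV0
    have hW0 : (W 0).toLinearMap = LinearMap.id :=
      LinearMap.ext fun v => by simp [W, displacement_zero]
    simp only [hV0', hW0, TensorProduct.map_id, LinearMap.id_apply, e.apply_symm_apply]
  · intro t ψ χ
    rw [inner_tensorDomainEquiv, TensorProduct.inner_map_map, ← inner_tensorDomainEquiv,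
      e.apply_symm_apply, e.apply_symm_apply]
  · exact fun t ψ => hasDerivAt_tensorDomainEquiv_map (fun u => hV t u)
      (fun v => hasDerivAt_displacement h v t) (e.symm ψ)

end TensorDomain

section FieldMap

variable {H₀ : Type*} [NormedAddCommGroup H₀] [InnerProductSpace ℂ H₀]
  {E : Type*} [NormedAddCommGroup E] [InnerProductSpace ℂ E]

theorem fieldOp_add (h h' : E) : fieldOp (h + h') = fieldOp h + fieldOp h' := by
  refine LinearMap.ext fun v => ?_
  induction v using expDomain_induction with
  | hexp g =>
    simp only [LinearMap.add_apply, fieldOp_expDomainVec, inner_add_left, map_add, add_smul]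
    abel
  | hadd u v hu hv => rw [map_add, map_add, hu, hv]
  | hsmul c v hv => rw [map_smul, map_smul, hv]

theorem fieldOp_real_smul (r : ℝ) (h : E) : fieldOp (r • h) = (r : ℂ) • fieldOp h := by
  refine LinearMap.ext fun v => ?_
  induction v using expDomain_induction with
  | hexp g =>
    rw [RCLike.real_smul_eq_coe_smul (K := ℂ) r h]
    simp only [LinearMap.smul_apply, fieldOp_expDomainVec, inner_smul_left, map_smul, smul_add,
      smul_smul]
    simp
  | hadd u v hu hv => rw [map_add, map_add, hu, hv]
  | hsmul c v hv => rw [map_smul, map_smul, hv]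

/-- The ampliated field operator, applied to a fixed vector of the domain, as a real linear function
of the test function. -/
def fieldCLM (P : Submodule ℂ H₀) (ψ : tensorDomain E P) : E →L[ℝ] SystemFieldSpace H₀ E where
  toFun h := fieldAmpl P (fieldOp h) ψ
  map_add' h h' := by
    rw [fieldOp_add]
    simp only [fieldAmpl, TensorProduct.map_add_right, LinearMap.comp_apply, LinearMap.add_apply,
      map_add]
  map_smul' r h := by
    rw [fieldOp_real_smul, RingHom.id_apply, ← Complex.coe_smul]
    simp only [fieldAmpl, TensorProduct.map_smul_right, LinearMap.comp_apply, LinearMap.smul_apply,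
      map_smul]
  cont := continuous_fieldAmpl P ψ

theorem fieldCLM_apply (P : Submodule ℂ H₀) (ψ : tensorDomain E P) (h : E) :
    fieldCLM P ψ h = fieldAmpl P (fieldOp h) ψ := rfl

variable {n μ : ℕ} {X₀ : Fin n → H₀ →ₗ.[ℂ] H₀} {Θ : Matrix (Fin n) (Fin n) ℝ}

theorem sum_smul_initialOp (a : Fin n → ℝ) :
    ∑ j, (a j : ℂ) • initialOp μ X₀ j = systemAmpl (initialComb X₀ a) := by
  refine LinearMap.ext fun ψ => ?_
  obtain ⟨x, rfl⟩ := (tensorDomainEquiv (OneParticle μ) (initialDomain X₀)).surjective ψ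
  simp only [LinearMap.sum_apply, LinearMap.smul_apply, initialOp, systemAmpl_tensorDomainEquiv,
    ← map_smul, ← map_sum]
  congr 1
  induction x using TensorProduct.induction_on with
  | zero => simp
  | add x y hx hy => simp only [map_add, smul_add, Finset.sum_add_distrib, hx, hy]
  | tmul u v =>
    simp only [TensorProduct.map_tmul, TensorProduct.smul_tmul', ← TensorProduct.sum_tmul]
    congr 1
    simp [initialComb]

/-- The real affine combinations of the initial variables and a field operator. They contain all
operators of the expansion and are self-adjoint quantum variables. -/
def IsFieldAffine (S : DomainOp μ X₀) : Prop :=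
  ∃ (a : Fin n → ℝ) (h : OneParticle μ),
    ∀ ψ, S ψ = ∑ j, (a j : ℂ) • initialOp μ X₀ j ψ + fieldCLM _ ψ h

theorem IsFieldAffine.isQuantumVariable [CompleteSpace H₀] (hΘ : Θᵀ = -Θ)
    (hX₀ : SatisfiesWeylCCR Θ X₀) {S : DomainOp μ X₀} (hS : IsFieldAffine S) :
    IsQuantumVariable S := by
  obtain ⟨a, h, hS⟩ := hS
  obtain ⟨V, hV0, hV⟩ := exists_hasDerivAt_initialComb hΘ hX₀ a
  convert isQuantumVariable_systemAmpl_add_fieldAmpl (dense_initialDomain hΘ hX₀) hV0 hV h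
  refine LinearMap.ext fun ψ => ?_
  rw [hS, LinearMap.add_apply, ← sum_smul_initialOp]
  simp [fieldCLM_apply]

end FieldMap

section Frequencies

theorem freq_pos {T : ℝ} (hT : 0 < T) (k : ℕ) : 0 < freq T k := by
  have := Real.pi_pos
  unfold freq
  positivity

theorem freq_injective {T : ℝ} (hT : 0 < T) : Function.Injective (freq T) := fun k l h => by
  have h' := mul_left_cancel₀ (div_pos Real.pi_pos hT).ne' h
  exact_mod_cast add_right_cancel h'

theorem freq_mul_self {T : ℝ} (hT : 0 < T) (k : ℕ) :
    freq T k * T = k * Real.pi + Real.pi / 2 := by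
  unfold freq
  field_simp

theorem sineFun_zero (T : ℝ) (k : ℕ) : sineFun T k 0 = 0 := by
  simp [sineFun]

theorem cosineFun_zero (T : ℝ) (k : ℕ) : cosineFun T k 0 = √(2 / T) := by
  simp [cosineFun]

theorem sineFun_self {T : ℝ} (hT : 0 < T) (k : ℕ) : sineFun T k T = √(2 / T) * (-1) ^ k := by
  rw [sineFun, freq_mul_self hT, Real.sin_add_pi_div_two, Real.cos_nat_mul_pi]

theorem cosineFun_self {T : ℝ} (hT : 0 < T) (k : ℕ) : cosineFun T k T = 0 := by
  rw [cosineFun, freq_mul_self hT, Real.cos_add_pi_div_two, Real.sin_nat_mul_pi, neg_zero,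
    mul_zero]

theorem sineFun_sq_add_cosineFun_sq {T : ℝ} (hT : 0 < T) (k : ℕ) (t : ℝ) :
    sineFun T k t ^ 2 + cosineFun T k t ^ 2 = 2 / T := by
  rw [sineFun, cosineFun, mul_pow, mul_pow, ← mul_add, Real.sin_sq_add_cos_sq, mul_one,
    Real.sq_sqrt (by positivity)]

theorem hasDerivAt_sineFun (T : ℝ) (k : ℕ) (t : ℝ) :
    HasDerivAt (sineFun T k) (freq T k * cosineFun T k t) t := by
  refine (((hasDerivAt_id t).const_mul (freq T k)).sin.const_mul √(2 / T)).congr_deriv ?_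
  simp only [cosineFun, id_eq, mul_one]
  ring

theorem hasDerivAt_cosineFun (T : ℝ) (k : ℕ) (t : ℝ) :
    HasDerivAt (cosineFun T k) (-(freq T k * sineFun T k t)) t := by
  refine (((hasDerivAt_id t).const_mul (freq T k)).cos.const_mul √(2 / T)).congr_deriv ?_
  simp only [sineFun, id_eq, mul_one]
  ring

theorem continuous_cosineFun (T : ℝ) (k : ℕ) : Continuous (cosineFun T k) := by
  unfold cosineFun
  fun_prop

theorem integral_sineFun_sq {T : ℝ} (hT : 0 < T) (k : ℕ) :
    ∫ s in (0 : ℝ)..T, sineFun T k s * sineFun T k s = 1 := by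
  have hω := (freq_pos hT k).ne'
  have hderiv (s : ℝ) : HasDerivAt
      (fun s => s / T - sineFun T k s * cosineFun T k s / (2 * freq T k))
      (sineFun T k s * sineFun T k s) s := by
    refine (((hasDerivAt_id s).div_const T).sub (((hasDerivAt_sineFun T k s).mul
      (hasDerivAt_cosineFun T k s)).div_const _)).congr_deriv ?_
    have hsq := sineFun_sq_add_cosineFun_sq hT k s
    field_simp at hsq ⊢
    linear_combination -hsq
  rw [intervalIntegral.integral_eq_sub_of_hasDerivAt (fun s _ => hderiv s)
    (((continuous_sineFun T k).mul (continuous_sineFun T k)).intervalIntegrable _ _)]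
  simp [cosineFun_self hT, sineFun_zero, hT.ne']

theorem integral_sineFun_mul_sineFun_of_ne {T : ℝ} (hT : 0 < T) {k l : ℕ} (hkl : k ≠ l) :
    ∫ s in (0 : ℝ)..T, sineFun T k s * sineFun T l s = 0 := by
  have hω : freq T l ^ 2 - freq T k ^ 2 ≠ 0 := fun h => hkl (freq_injective hT
    ((sq_eq_sq₀ (freq_pos hT k).le (freq_pos hT l).le).1 (sub_eq_zero.1 h).symm))
  have hderiv (s : ℝ) : HasDerivAt
      (fun s => (freq T k * (cosineFun T k s * sineFun T l s)
        - freq T l * (sineFun T k s * cosineFun T l s)) / (freq T l ^ 2 - freq T k ^ 2))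
      (sineFun T k s * sineFun T l s) s := by
    refine (((((hasDerivAt_cosineFun T k s).mul (hasDerivAt_sineFun T l s)).const_mul _).sub
      (((hasDerivAt_sineFun T k s).mul (hasDerivAt_cosineFun T l s)).const_mul _)).div_const
        _).congr_deriv ?_
    field_simp
    ring
  rw [intervalIntegral.integral_eq_sub_of_hasDerivAt (fun s _ => hderiv s)
    (((continuous_sineFun T k).mul (continuous_sineFun T l)).intervalIntegrable _ _)]
  simp [cosineFun_self hT, sineFun_zero]

end Frequencies

section MinKernel

theorem integral_mul_min {g g' g'' : ℝ → ℝ} (hg : ∀ t, HasDerivAt g (g' t) t)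
    (hg' : ∀ t, HasDerivAt g' (g'' t) t) (hg'' : Continuous g'') {t T : ℝ} (ht : 0 ≤ t)
    (htT : t ≤ T) : ∫ s in (0 : ℝ)..T, g'' s * min s t = t * g' T - g t + g 0 := by
  have hcont : Continuous fun s => g'' s * min s t := by fun_prop
  have hleft : ∫ s in (0 : ℝ)..t, g'' s * min s t = (g' t * t - g t) - (g' 0 * 0 - g 0) := calc
    _ = ∫ s in (0 : ℝ)..t, g'' s * s := by
      refine intervalIntegral.integral_congr fun s hs => ?_
      rw [Set.uIcc_of_le ht] at hs
      simp only [min_eq_left hs.2]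
    _ = _ := by
      refine intervalIntegral.integral_eq_sub_of_hasDerivAt (f := fun s => g' s * s - g s)
        (fun s _ => ?_) (Continuous.intervalIntegrable (by fun_prop) _ _)
      refine (((hg' s).mul (hasDerivAt_id s)).sub (hg s)).congr_deriv ?_
      simp
  have hright : ∫ s in t..T, g'' s * min s t = g' T * t - g' t * t := calc
    _ = ∫ s in t..T, g'' s * t := by
      refine intervalIntegral.integral_congr fun s hs => ?_
      rw [Set.uIcc_of_le htT] at hs
      simp only [min_eq_right hs.1]
    _ = _ := intervalIntegral.integral_eq_sub_of_hasDerivAt (f := fun s => g' s * t)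
      (fun s _ => (hg' s).mul_const t) (Continuous.intervalIntegrable (by fun_prop) _ _)
  rw [← intervalIntegral.integral_add_adjacent_intervals (b := t)
    (hcont.intervalIntegrable _ _) (hcont.intervalIntegrable _ _), hleft, hright]
  ring

theorem integral_sineFun_mul_min {T : ℝ} (hT : 0 < T) (k : ℕ) {t : ℝ} (ht : t ∈ Set.Icc 0 T) :
    ∫ s in (0 : ℝ)..T, sineFun T k s * min s t = sineFun T k t / freq T k ^ 2 := by
  have hω := (freq_pos hT k).ne'
  rw [integral_mul_min (g := fun s => -(sineFun T k s / freq T k ^ 2))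
    (g' := fun s => -(cosineFun T k s / freq T k)) (fun s => ?_) (fun s => ?_)
    (continuous_sineFun T k) ht.1 ht.2]
  · simp [cosineFun_self hT, sineFun_zero]
  · refine ((hasDerivAt_sineFun T k s).div_const _).neg.congr_deriv ?_
    field_simp
  · refine ((hasDerivAt_cosineFun T k s).div_const _).neg.congr_deriv ?_
    field_simp

theorem hasSum_cos_div_sq {x : ℝ} (hx : x ∈ Set.Icc (0 : ℝ) 1) :
    HasSum (fun n : ℕ => 1 / (n : ℝ) ^ 2 * Real.cos (2 * Real.pi * n * x))
      (Real.pi ^ 2 * (x ^ 2 - x + 6⁻¹)) := by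
  have h := hasSum_one_div_nat_pow_mul_cos one_ne_zero hx
  change HasSum _ (_ * bernoulliFun 2 x) at h
  have hfactor : (-1 : ℝ) ^ (1 + 1) * (2 * Real.pi) ^ (2 * 1) / 2 / (2 * 1).factorial
      = Real.pi ^ 2 := by
    norm_num [Nat.factorial]
    ring
  rwa [bernoulliFun_two, hfactor] at h

theorem hasSum_cos_odd_div_sq {x : ℝ} (hx : x ∈ Set.Icc (0 : ℝ) (1 / 2)) :
    HasSum (fun k : ℕ => 1 / ((2 * k + 1 : ℕ) : ℝ) ^ 2 *
      Real.cos (2 * Real.pi * ((2 * k + 1 : ℕ) : ℝ) * x)) (Real.pi ^ 2 * (1 / 8 - x / 2)) := by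
  let f : ℕ → ℝ := fun n => 1 / (n : ℝ) ^ 2 * Real.cos (2 * Real.pi * n * x)
  have hall : HasSum f (Real.pi ^ 2 * (x ^ 2 - x + 6⁻¹)) :=
    hasSum_cos_div_sq ⟨hx.1, by linarith [hx.2]⟩
  have heven : HasSum (fun k : ℕ => f (2 * k))
      (1 / 4 * (Real.pi ^ 2 * ((2 * x) ^ 2 - 2 * x + 6⁻¹))) := by
    refine ((hasSum_cos_div_sq (x := 2 * x) ⟨by linarith [hx.1], by linarith [hx.2]⟩).mul_left
      (1 / 4)).congr_fun fun k => ?_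
    have harg : 2 * Real.pi * ((2 * k : ℕ) : ℝ) * x = 2 * Real.pi * k * (2 * x) := by
      push_cast
      ring
    simp only [f, harg]
    push_cast
    ring
  have hinj : Function.Injective fun k : ℕ => 2 * k + 1 := fun a b h => by simpa using h
  have hodd : HasSum (fun k : ℕ => f (2 * k + 1)) (∑' k : ℕ, f (2 * k + 1)) :=
    (hall.summable.comp_injective hinj).hasSum
  have hsum := (HasSum.even_add_odd heven hodd).unique hall
  have htsum : ∑' k : ℕ, f (2 * k + 1) = Real.pi ^ 2 * (1 / 8 - x / 2) := by
    linear_combination hsum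
  exact htsum ▸ hodd

/-- Mercer's expansion of the kernel `min s t` on the diagonal. -/
theorem hasSum_sineFun_div_freq_sq {T : ℝ} (hT : 0 < T) {t : ℝ} (ht : t ∈ Set.Icc 0 T) :
    HasSum (fun k => (sineFun T k t / freq T k) ^ 2) t := by
  have hx : t / (2 * T) ∈ Set.Icc (0 : ℝ) (1 / 2) := by
    refine ⟨by have := ht.1; positivity, ?_⟩
    rw [div_le_div_iff₀ (by positivity) (by norm_num)]
    linarith [ht.2]
  have hsum := ((hasSum_cos_odd_div_sq ⟨le_rfl, by norm_num⟩).sub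
    (hasSum_cos_odd_div_sq hx)).mul_left (4 * T / Real.pi ^ 2)
  have hvalue : 4 * T / Real.pi ^ 2 * (Real.pi ^ 2 * (1 / 8 - 0 / 2)
      - Real.pi ^ 2 * (1 / 8 - t / (2 * T) / 2)) = t := by
    have := Real.pi_pos.ne'
    field_simp
    ring
  rw [hvalue] at hsum
  refine hsum.congr_fun fun k => ?_
  have hcos : Real.cos (2 * Real.pi * ((2 * k + 1 : ℕ) : ℝ) * (t / (2 * T)))
      = 1 - 2 * Real.sin (freq T k * t) ^ 2 := by
    rw [show 2 * Real.pi * ((2 * k + 1 : ℕ) : ℝ) * (t / (2 * T)) = 2 * (freq T k * t) by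
      unfold freq; push_cast; field_simp, Real.cos_two_mul]
    linear_combination (2 : ℝ) * Real.sin_sq_add_cos_sq (freq T k * t)
  rw [hcos, sineFun, div_pow, mul_pow, Real.sq_sqrt (by positivity), mul_zero, Real.cos_zero]
  unfold freq
  push_cast
  have : (2 * (k : ℝ) + 1) ≠ 0 := by positivity
  have : ((k : ℝ) + 1 / 2) ≠ 0 := by positivity
  field_simp
  ring

end MinKernel

section Orthonormal

variable {𝕜 F ι : Type*} [RCLike 𝕜] [NormedAddCommGroup F] [InnerProductSpace 𝕜 F]

theorem hasSum_inner_smul_of_hasSum_norm_sq {e : ι → F} (he : Orthonormal 𝕜 e) {x : F}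
    (hx : HasSum (fun k => ‖inner 𝕜 (e k) x‖ ^ 2) (‖x‖ ^ 2)) :
    HasSum (fun k => inner 𝕜 (e k) x • e k) x := by
  have hnorm (s : Finset ι) : ‖∑ k ∈ s, inner 𝕜 (e k) x • e k - x‖ ^ 2 =
      ‖x‖ ^ 2 - ∑ k ∈ s, ‖inner 𝕜 (e k) x‖ ^ 2 := by
    have hinner : inner 𝕜 x (∑ k ∈ s, inner 𝕜 (e k) x • e k) =
        ((∑ k ∈ s, ‖inner 𝕜 (e k) x‖ ^ 2 : ℝ) : 𝕜) := by
      simp only [inner_sum, inner_smul_right, RCLike.ofReal_sum, RCLike.ofReal_pow,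
        ← RCLike.mul_conj, inner_conj_symm]
    have hsum : ‖∑ k ∈ s, inner 𝕜 (e k) x • e k‖ ^ 2 = ∑ k ∈ s, ‖inner 𝕜 (e k) x‖ ^ 2 := by
      simpa using he.orthogonalFamily.norm_sum (fun k => inner 𝕜 (e k) x) s
    rw [norm_sub_rev, @norm_sub_sq 𝕜, hinner, hsum, RCLike.ofReal_re]
    ring
  rw [HasSum, tendsto_iff_norm_sub_tendsto_zero]
  have hlim : Filter.Tendsto (fun s : Finset ι => √(‖x‖ ^ 2 - ∑ k ∈ s, ‖inner 𝕜 (e k) x‖ ^ 2))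
      Filter.atTop (nhds 0) := by
    have h := (Filter.Tendsto.const_sub (‖x‖ ^ 2) hx).sqrt
    rwa [sub_self, Real.sqrt_zero] at h
  refine hlim.congr fun s => ?_
  rw [← hnorm, Real.sqrt_sq (norm_nonneg _)]

end Orthonormal

section KarhunenLoeve

variable {F : Type*} [NormedAddCommGroup F] [InnerProductSpace ℂ F]

/-- A continuous curve in a Hilbert space with the covariance function `min s t` of the Wiener
process. -/
structure IsWienerCurve (b : ℝ → F) : Prop where
  continuous : Continuous b
  inner_eq : ∀ s t, 0 ≤ s → 0 ≤ t → ⟪b s, b t⟫_ℂ = (min s t : ℝ)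

theorem isWienerCurve_wienerTest {μ : ℕ} (j : Fin 2 × Fin μ) :
    IsWienerCurve fun t => wienerTest t j := by
  open MeasureTheory in
  refine ⟨continuous_wienerTest j, fun s t hs ht => ?_⟩
  have hfin (r : ℝ) : (volume.restrict (Set.Ici (0 : ℝ))) (Set.Icc 0 r) ≠ ⊤ :=
    ((Measure.restrict_apply_le _ _).trans_lt measure_Icc_lt_top).ne
  have hvol : (volume.restrict (Set.Ici (0 : ℝ))).real (Set.Icc 0 s ∩ Set.Icc 0 t) = min s t := by
    rw [Set.Icc_inter_Icc, sup_idem, measureReal_restrict_apply measurableSet_Icc,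
      Set.inter_eq_left.2 Set.Icc_subset_Ici_self, Real.volume_real_Icc_of_le (le_min hs ht),
      sub_zero]
  rw [wienerTest, wienerTest, L2.inner_indicatorConstLp_indicatorConstLp _ _ (hfin s) (hfin t),
    hvol]
  split_ifs <;> simp

theorem IsWienerCurve.norm_sq {b : ℝ → F} (hb : IsWienerCurve b) {t : ℝ} (ht : 0 ≤ t) :
    ‖b t‖ ^ 2 = t := by
  rw [← inner_self_eq_norm_sq (𝕜 := ℂ), hb.inner_eq t t ht ht]
  simp

/-- The Karhunen-Loeve coefficients `ω_k ∫_0^T f_k(t) b(t) dt` of a curve `b`. -/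
def klVec (b : ℝ → F) (T : ℝ) (k : ℕ) : F :=
  freq T k • ∫ t in (0 : ℝ)..T, sineFun T k t • b t

variable [CompleteSpace F]

theorem klVec_map {b : ℝ → F} (hb : Continuous b) {G : Type*} [NormedAddCommGroup G]
    [NormedSpace ℝ G] [CompleteSpace G] (L : F →L[ℝ] G) (T : ℝ) (k : ℕ) :
    L (klVec b T k) = freq T k • ∫ t in (0 : ℝ)..T, sineFun T k t • L (b t) := by
  have hcont : Continuous fun t => sineFun T k t • b t := (continuous_sineFun T k).smul hb
  rw [klVec, map_smul, ← L.intervalIntegral_comp_comm (hcont.intervalIntegrable _ _)]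
  simp only [map_smul]

theorem inner_klVec {b : ℝ → F} (hb : Continuous b) {q : F} {T : ℝ} (hT : 0 < T) {r : ℝ → ℝ}
    (hr : ∀ t ∈ Set.Icc 0 T, ⟪q, b t⟫_ℂ = r t) (k : ℕ) :
    ⟪q, klVec b T k⟫_ℂ = (freq T k * ∫ t in (0 : ℝ)..T, sineFun T k t * r t : ℝ) := by
  have hint : ∫ t in (0 : ℝ)..T, sineFun T k t • ⟪q, b t⟫_ℂ =
      ∫ t in (0 : ℝ)..T, ((sineFun T k t * r t : ℝ) : ℂ) := by
    refine intervalIntegral.integral_congr fun t ht => ?_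
    rw [Set.uIcc_of_le hT.le] at ht
    simp only [hr t ht, Complex.real_smul, Complex.ofReal_mul]
  refine (klVec_map hb ((innerSL ℂ q).restrictScalars ℝ) T k).trans ?_
  simp only [ContinuousLinearMap.coe_restrictScalars', innerSL_apply_apply]
  rw [hint, intervalIntegral.integral_ofReal, Complex.real_smul, ← Complex.ofReal_mul]

namespace IsWienerCurve

variable {b : ℝ → F} {T : ℝ}

theorem inner_klVec_right (hb : IsWienerCurve b) (hT : 0 < T) (k : ℕ) {t : ℝ}
    (ht : t ∈ Set.Icc 0 T) : ⟪b t, klVec b T k⟫_ℂ = (sineFun T k t / freq T k : ℝ) := by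
  have hω := (freq_pos hT k).ne'
  rw [inner_klVec hb.continuous hT (r := fun s => min s t)
    (fun s hs => by rw [hb.inner_eq t s ht.1 hs.1, min_comm]), integral_sineFun_mul_min hT k ht]
  congr 1
  field_simp

theorem inner_klVec_left (hb : IsWienerCurve b) (hT : 0 < T) (k : ℕ) {t : ℝ}
    (ht : t ∈ Set.Icc 0 T) : ⟪klVec b T k, b t⟫_ℂ = (sineFun T k t / freq T k : ℝ) := by
  rw [← inner_conj_symm, hb.inner_klVec_right hT k ht, Complex.conj_ofReal]

theorem inner_klVec_klVec (hb : IsWienerCurve b) (hT : 0 < T) (k l : ℕ) :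
    ⟪klVec b T l, klVec b T k⟫_ℂ =
      (freq T k / freq T l * ∫ s in (0 : ℝ)..T, sineFun T k s * sineFun T l s : ℝ) := by
  rw [inner_klVec hb.continuous hT (fun s hs => hb.inner_klVec_left hT l hs)]
  simp only [← mul_div_assoc, intervalIntegral.integral_div]
  congr 1
  ring

theorem orthonormal_klVec (hb : IsWienerCurve b) (hT : 0 < T) : Orthonormal ℂ (klVec b T) := by
  rw [orthonormal_iff_ite]
  intro l k
  rcases eq_or_ne l k with rfl | hne
  · rw [hb.inner_klVec_klVec hT, integral_sineFun_sq hT, div_self (freq_pos hT l).ne']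
    simp
  · rw [if_neg hne, hb.inner_klVec_klVec hT, integral_sineFun_mul_sineFun_of_ne hT hne.symm,
      mul_zero, Complex.ofReal_zero]

theorem hasSum_klVec (hb : IsWienerCurve b) (hT : 0 < T) {t : ℝ} (ht : t ∈ Set.Icc 0 T) :
    HasSum (fun k => (sineFun T k t / freq T k) • klVec b T k) (b t) := by
  have hinner (k : ℕ) := hb.inner_klVec_left hT k ht
  refine (hasSum_inner_smul_of_hasSum_norm_sq (hb.orthonormal_klVec hT) ?_).congr_fun fun k => ?_
  · rw [hb.norm_sq ht.1]
    refine (hasSum_sineFun_div_freq_sq hT ht).congr_fun fun k => ?_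
    rw [hinner, Complex.norm_real, Real.norm_eq_abs, sq_abs]
  · rw [hinner, Complex.coe_smul]

theorem inner_smul_sub_integral (hb : IsWienerCurve b) {g g' g'' : ℝ → ℝ}
    (hg : ∀ t, HasDerivAt g (g' t) t) (hg' : ∀ t, HasDerivAt g' (g'' t) t) (hg'' : Continuous g'')
    {t : ℝ} (ht : t ∈ Set.Icc 0 T) :
    ⟪b t, g' T • b T - ∫ s in (0 : ℝ)..T, g'' s • b s⟫_ℂ = (g t - g 0 : ℝ) := by
  have hT : 0 ≤ T := ht.1.trans ht.2
  have hcont : Continuous fun s => g'' s • b s := hg''.smul hb.continuous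
  have hint : ⟪b t, ∫ s in (0 : ℝ)..T, g'' s • b s⟫_ℂ =
      ((∫ s in (0 : ℝ)..T, g'' s * min s t : ℝ) : ℂ) := by
    refine (((innerSL ℂ (b t)).restrictScalars ℝ).intervalIntegral_comp_comm
      (hcont.intervalIntegrable (μ := MeasureTheory.volume) 0 T)).symm.trans ?_
    rw [← intervalIntegral.integral_ofReal]
    refine intervalIntegral.integral_congr fun s hs => ?_
    rw [Set.uIcc_of_le hT] at hs
    simp only [map_smul, ContinuousLinearMap.coe_restrictScalars', innerSL_apply_apply,
      hb.inner_eq t s ht.1 hs.1, min_comm t s, Complex.real_smul, Complex.ofReal_mul]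
  rw [inner_sub_right, hint, RCLike.real_smul_eq_coe_smul (K := ℂ), inner_smul_right,
    hb.inner_eq t T ht.1 hT, min_eq_left ht.2, integral_mul_min hg hg' hg'' ht.1 ht.2]
  change (g' T : ℂ) * _ - _ = _
  push_cast
  ring

theorem hasSum_sineFun_mul_integral_inner (hb : IsWienerCurve b) (hT : 0 < T) {q : F} {r : ℝ → ℝ}
    (hr : ∀ t ∈ Set.Icc 0 T, ⟪q, b t⟫_ℂ = r t) {t : ℝ} (ht : t ∈ Set.Icc 0 T) :
    HasSum (fun k => sineFun T k t * ∫ s in (0 : ℝ)..T, sineFun T k s * r s) (r t) := by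
  have hsum := Complex.hasSum_re
    ((hb.hasSum_klVec hT ht).mapL ((innerSL ℂ q).restrictScalars ℝ))
  simp only [map_smul, ContinuousLinearMap.coe_restrictScalars', innerSL_apply_apply, hr t ht,
    inner_klVec hb.continuous hT hr, Complex.real_smul, ← Complex.ofReal_mul,
    Complex.ofReal_re] at hsum
  refine hsum.congr_fun fun k => ?_
  have := (freq_pos hT k).ne'
  field_simp

end IsWienerCurve

theorem hasSum_sineFun_mul_integral {T : ℝ} (hT : 0 < T) {g g' g'' : ℝ → ℝ}
    (hg : ∀ t, HasDerivAt g (g' t) t) (hg' : ∀ t, HasDerivAt g' (g'' t) t) (hg'' : Continuous g'')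
    (h0 : g 0 = 0) {t : ℝ} (ht : t ∈ Set.Icc 0 T) :
    HasSum (fun k => sineFun T k t * ∫ s in (0 : ℝ)..T, sineFun T k s * g s) (g t) := by
  have hb : IsWienerCurve fun t => (wienerTest t (0, 0) : OneParticle 1) :=
    isWienerCurve_wienerTest (0, 0)
  -- Represent `g` as the inner product of a fixed vector with a Wiener curve.
  let q : OneParticle 1 :=
    g' T • wienerTest T (0, 0) - ∫ s in (0 : ℝ)..T, g'' s • wienerTest s (0, 0)
  refine hb.hasSum_sineFun_mul_integral_inner hT (q := q) (fun s hs => ?_) ht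
  rw [← inner_conj_symm]
  refine (congrArg conj (hb.inner_smul_sub_integral hg hg' hg'' hs)).trans ?_
  rw [h0, sub_zero, Complex.conj_ofReal]

end KarhunenLoeve

section MatrixCoefficients

open Filter

variable {n : ℕ} {A : Matrix (Fin n) (Fin n) ℝ} {T : ℝ} {k : ℕ}

theorem map_mhoInv_eq_mul (A : Matrix (Fin n) (Fin n) ℝ) (T : ℝ) (k : ℕ) :
    (mhoInv A T k).map Complex.ofReal =
      (algebraMap ℂ (Matrix (Fin n) (Fin n) ℂ) (freq T k * Complex.I) - A.map Complex.ofReal)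
        * (algebraMap ℂ (Matrix (Fin n) (Fin n) ℂ) (-(freq T k * Complex.I))
          - A.map Complex.ofReal) := by
  have hmap : (mhoInv A T k).map Complex.ofReal =
      algebraMap ℂ (Matrix (Fin n) (Fin n) ℂ) ((freq T k : ℂ) ^ 2)
        + A.map Complex.ofReal * A.map Complex.ofReal := by
    change Complex.ofRealHom.mapMatrix (mhoInv A T k) = _
    rw [mhoInv, sq A, map_add, map_mul]
    congr 1
    ext i j
    simp only [Matrix.algebraMap_matrix_apply, RingHom.mapMatrix_apply, Matrix.map_apply,
      Matrix.smul_apply, Matrix.one_apply]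
    split_ifs <;> simp
  have hsq : (freq T k : ℂ) * Complex.I * -(freq T k * Complex.I) = (freq T k : ℂ) ^ 2 := by
    linear_combination (-(freq T k : ℂ) ^ 2) * Complex.I_sq
  rw [hmap, sub_mul, mul_sub, mul_sub, ← map_mul, hsq, map_neg,
    Algebra.commutes (freq T k * Complex.I)]
  noncomm_ring

theorem isUnit_mhoInv (hA : IsHurwitz A) (T : ℝ) (k : ℕ) : IsUnit (mhoInv A T k) := by
  have hunit (z : ℂ) (hz : z.re = 0) :
      IsUnit (algebraMap ℂ (Matrix (Fin n) (Fin n) ℂ) z - A.map Complex.ofReal) := by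
    by_contra h
    exact (hA z h).ne hz
  have hmap := (hunit (freq T k * Complex.I) (by simp)).mul
    (hunit (-(freq T k * Complex.I)) (by simp))
  rw [← map_mhoInv_eq_mul, Matrix.isUnit_iff_isUnit_det, isUnit_iff_ne_zero] at hmap
  rw [Matrix.isUnit_iff_isUnit_det, isUnit_iff_ne_zero]
  refine fun hdet => hmap ((Complex.ofRealHom.map_det (mhoInv A T k)).symm.trans ?_)
  rw [hdet, map_zero]

theorem mhoInv_mul_mho (h : IsUnit (mhoInv A T k)) : mhoInv A T k * mho A T k = 1 :=
  Matrix.mul_nonsing_inv _ ((Matrix.isUnit_iff_isUnit_det _).1 h)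

theorem mho_mul_mhoInv (h : IsUnit (mhoInv A T k)) : mho A T k * mhoInv A T k = 1 :=
  Matrix.nonsing_inv_mul _ ((Matrix.isUnit_iff_isUnit_det _).1 h)

theorem freq_sq_smul_mho (h : IsUnit (mhoInv A T k)) :
    freq T k ^ 2 • mho A T k = 1 - A * (A * mho A T k) := by
  have hmul := mhoInv_mul_mho h
  rw [mhoInv, add_mul, Matrix.smul_mul, one_mul, sq A, mul_assoc] at hmul
  exact eq_sub_of_add_eq hmul

theorem commute_mho (h : IsUnit (mhoInv A T k)) : Commute A (mho A T k) := by
  have hcomm : A * mhoInv A T k = mhoInv A T k * A := by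
    simp only [mhoInv, mul_add, add_mul, sq, Matrix.mul_smul, Matrix.smul_mul, mul_one, one_mul,
      mul_assoc]
  calc A * mho A T k = mho A T k * mhoInv A T k * (A * mho A T k) := by
        rw [mho_mul_mhoInv h, one_mul]
    _ = mho A T k * (A * mhoInv A T k) * mho A T k := by rw [hcomm]; simp only [mul_assoc]
    _ = mho A T k * A := by rw [mul_assoc, mul_assoc, mhoInv_mul_mho h, mul_one]

theorem expCoeff_eq (hT : 0 < T) (h : IsUnit (mhoInv A T k)) :
    expCoeff A T k = √(2 / T) • (mho A T k * ((-1 : ℝ) ^ k • (A * NormedSpace.exp (T • A))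
      + freq T k • 1)) - (√(2 / T) / freq T k) • 1 := by
  have hω := (freq_pos hT k).ne'
  have hone : (freq T k)⁻¹ • (1 : Matrix (Fin n) (Fin n) ℝ) =
      freq T k • mho A T k + (freq T k)⁻¹ • (mho A T k * (A * A)) := by
    rw [← mho_mul_mhoInv h, mhoInv, mul_add, smul_add, Matrix.mul_smul, mul_one, smul_smul, sq A]
    congr 2
    field_simp
  rw [expCoeff, div_eq_mul_inv √(2 / T), mul_smul, hone, ← smul_sub, (commute_mho h).eq]
  simp only [mul_add, mul_sub, Matrix.mul_smul, mul_one, mul_assoc]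
  abel_nf

theorem tendsto_freq_atTop (hT : 0 < T) : Tendsto (freq T) atTop atTop :=
  (tendsto_atTop_add_const_right _ _ tendsto_natCast_atTop_atTop).const_mul_atTop
    (div_pos Real.pi_pos hT)

theorem summable_inv_freq_sq (hT : 0 < T) : Summable fun k => (freq T k)⁻¹ ^ 2 := by
  refine ((hasSum_sineFun_div_freq_sq hT ⟨hT.le, le_rfl⟩).summable.mul_left (T / 2)).congr
    fun k => ?_
  rw [sineFun_self hT, div_pow, mul_pow, Real.sq_sqrt (by positivity), ← pow_mul, mul_comm k,
    pow_mul, neg_one_sq, one_pow]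
  field_simp

section Norm

attribute [local instance] Matrix.linftyOpNormedAddCommGroup Matrix.linftyOpNormedSpace
  Matrix.linftyOpNormedRing Matrix.linftyOpNormedAlgebra

theorem abs_entry_le_linftyOpNorm {ι κ : Type*} [Fintype ι] [Fintype κ] (K : Matrix ι κ ℝ) (i : ι)
    (j : κ) : |K i j| ≤ ‖K‖ := by
  rw [Matrix.linfty_opNorm_def, ← Real.norm_eq_abs, ← coe_nnnorm, NNReal.coe_le_coe]
  exact (Finset.single_le_sum (f := fun j => ‖K i j‖₊) (fun _ _ => zero_le)
    (Finset.mem_univ j)).trans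
      (Finset.le_sup (f := fun i => ∑ j, ‖K i j‖₊) (Finset.mem_univ i))

theorem isBigO_mho (hA : ∀ k, IsUnit (mhoInv A T k)) (hT : 0 < T) :
    mho A T =O[atTop] fun k => (freq T k)⁻¹ ^ 2 := by
  refine Asymptotics.IsBigO.of_bound (2 * ‖(1 : Matrix (Fin n) (Fin n) ℝ)‖) ?_
  filter_upwards [(tendsto_freq_atTop hT).eventually_ge_atTop (2 * ‖A‖ + 1)] with k hk
  have hnorm : freq T k ^ 2 * ‖mho A T k‖ ≤ ‖(1 : Matrix (Fin n) (Fin n) ℝ)‖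
      + ‖A‖ * (‖A‖ * ‖mho A T k‖) := by
    calc freq T k ^ 2 * ‖mho A T k‖ = ‖1 - A * (A * mho A T k)‖ := by
          rw [← freq_sq_smul_mho (hA k), norm_smul, Real.norm_of_nonneg (sq_nonneg _)]
      _ ≤ _ := (norm_sub_le _ _).trans (add_le_add le_rfl ((norm_mul_le _ _).trans
          (mul_le_mul_of_nonneg_left (norm_mul_le _ _) (norm_nonneg _))))
  have hfreq : 2 * (‖A‖ * ‖A‖) ≤ freq T k ^ 2 := by nlinarith [norm_nonneg A]
  rw [norm_pow, norm_inv, Real.norm_of_nonneg (freq_pos hT k).le, inv_pow,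
    ← div_eq_mul_inv, le_div_iff₀ (by have := freq_pos hT k; positivity)]
  nlinarith [mul_le_mul_of_nonneg_right hfreq (norm_nonneg (mho A T k))]

variable {κ : Type*} [Fintype κ]

theorem summable_sq_entry_of_isBigO {ι : Type*} [Fintype ι] {K : ℕ → Matrix ι κ ℝ} (hT : 0 < T)
    (hK : K =O[atTop] fun k => (freq T k)⁻¹) (i : ι) (j : κ) : Summable fun k => K k i j ^ 2 :=
  summable_of_isBigO_nat (summable_inv_freq_sq hT)
    (((Asymptotics.isBigO_of_le _ fun k => abs_entry_le_linftyOpNorm (K k) i j).trans hK).pow 2)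

theorem isBigO_mul_mho_mul (hA : ∀ k, IsUnit (mhoInv A T k)) (hT : 0 < T)
    (K : Matrix (Fin n) (Fin n) ℝ) (B : Matrix (Fin n) κ ℝ) :
    (fun k => K * mho A T k * B) =O[atTop] fun k => (freq T k)⁻¹ ^ 2 := by
  refine Asymptotics.IsBigO.trans (Asymptotics.IsBigO.of_bound (‖K‖ * ‖B‖)
    (Eventually.of_forall fun k => ?_)) (isBigO_mho hA hT)
  calc ‖K * mho A T k * B‖ ≤ ‖K‖ * ‖mho A T k‖ * ‖B‖ := (Matrix.linfty_opNorm_mul _ _).trans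
        (mul_le_mul_of_nonneg_right (Matrix.linfty_opNorm_mul _ _) (norm_nonneg _))
    _ = ‖K‖ * ‖B‖ * ‖mho A T k‖ := by ring

theorem summable_sq_freq_smul_mho_mul (hA : ∀ k, IsUnit (mhoInv A T k)) (hT : 0 < T)
    (B : Matrix (Fin n) κ ℝ) (i : Fin n) (j : κ) :
    Summable fun k => (freq T k • (mho A T k * B)) i j ^ 2 := by
  refine summable_sq_entry_of_isBigO hT ?_ i j
  have hbound := (Asymptotics.isBigO_refl (freq T) atTop).smul (isBigO_mul_mho_mul hA hT 1 B)
  simp only [one_mul] at hbound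
  refine hbound.congr_right fun k => ?_
  have := (freq_pos hT k).ne'
  rw [smul_eq_mul]
  field_simp

theorem summable_sq_mul_mho_mul (hA : ∀ k, IsUnit (mhoInv A T k)) (hT : 0 < T)
    (K : Matrix (Fin n) (Fin n) ℝ) (B : Matrix (Fin n) κ ℝ) (i : Fin n) (j : κ) :
    Summable fun k => (K * mho A T k * B) i j ^ 2 := by
  refine summable_sq_entry_of_isBigO hT ((isBigO_mul_mho_mul hA hT K B).trans ?_) i j
  have hinv : Tendsto (fun k => (freq T k)⁻¹) atTop (nhds 0) :=
    tendsto_inv_atTop_zero.comp (tendsto_freq_atTop hT)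
  simpa [sq] using (hinv.isBigO_one ℝ).mul (Asymptotics.isBigO_refl _ atTop)

theorem hasDerivAt_exp_smul_matrix (A : Matrix (Fin n) (Fin n) ℝ) (t : ℝ) :
    HasDerivAt (fun s : ℝ => NormedSpace.exp (s • A)) (A * NormedSpace.exp (t • A)) t :=
  hasDerivAt_exp_smul_const' A t

theorem hasDerivAt_entry {ι κ : Type*} [Fintype ι] [Fintype κ] {G : ℝ → Matrix ι κ ℝ}
    {G' : Matrix ι κ ℝ} {t : ℝ} (h : HasDerivAt G G' t) (i : ι) (j : κ) :
    HasDerivAt (fun s => G s i j) (G' i j) t :=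
  (LinearMap.toContinuousLinearMap (Matrix.entryLinearMap ℝ ℝ i j)).hasFDerivAt.comp_hasDerivAt t h

theorem hasDerivAt_mul_exp_entry (K : Matrix (Fin n) (Fin n) ℝ) (i j : Fin n) (t : ℝ) :
    HasDerivAt (fun s : ℝ => (K * NormedSpace.exp (s • A)) i j)
      ((K * A * NormedSpace.exp (t • A)) i j) t := by
  rw [mul_assoc]
  exact hasDerivAt_entry ((hasDerivAt_exp_smul_matrix A t).const_mul K) i j

theorem hasDerivAt_exp_entry (i j : Fin n) (t : ℝ) :
    HasDerivAt (fun s : ℝ => NormedSpace.exp (s • A) i j) ((A * NormedSpace.exp (t • A)) i j) t :=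
  hasDerivAt_entry (hasDerivAt_exp_smul_matrix A t) i j

theorem hasDerivAt_mho_mul_sub_mul_exp (h : IsUnit (mhoInv A T k)) (t : ℝ) :
    HasDerivAt (fun s : ℝ => mho A T k * ((sineFun T k s • A - (freq T k * cosineFun T k s) • 1)
      * NormedSpace.exp (s • A))) (sineFun T k t • NormedSpace.exp (t • A)) t := by
  have hcoeff := ((hasDerivAt_sineFun T k t).smul_const A).sub
    (((hasDerivAt_cosineFun T k t).const_mul (freq T k)).smul_const
      (1 : Matrix (Fin n) (Fin n) ℝ))
  refine ((hcoeff.mul (hasDerivAt_exp_smul_matrix A t)).const_mul (mho A T k)).congr_deriv ?_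
  have hmhoInv : (freq T k * cosineFun T k t) • A - (freq T k * -(freq T k * sineFun T k t)) • 1
      + (sineFun T k t • A - (freq T k * cosineFun T k t) • 1) * A
      = sineFun T k t • mhoInv A T k := by
    rw [mhoInv, sub_mul, smul_add, smul_smul, sq A, Matrix.smul_mul, Matrix.smul_mul, one_mul]
    module
  calc _ = mho A T k * (((freq T k * cosineFun T k t) • A
          - (freq T k * -(freq T k * sineFun T k t)) • 1
        + (sineFun T k t • A - (freq T k * cosineFun T k t) • 1) * A)
        * NormedSpace.exp (t • A)) := by rw [add_mul, mul_assoc _ A]; rfl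
    _ = _ := by
      rw [hmhoInv, Matrix.smul_mul, Matrix.mul_smul, ← mul_assoc, mho_mul_mhoInv h, one_mul]

theorem integral_sineFun_mul_exp_entry (h : IsUnit (mhoInv A T k)) (hT : 0 < T) (i j : Fin n) :
    ∫ s in (0 : ℝ)..T, sineFun T k s * NormedSpace.exp (s • A) i j =
      (√(2 / T) • (mho A T k * ((-1 : ℝ) ^ k • (A * NormedSpace.exp (T • A)) + freq T k • 1)))
        i j := by
  have hcont : Continuous fun s : ℝ => NormedSpace.exp (s • A) i j :=
    continuous_iff_continuousAt.2 fun s => (hasDerivAt_exp_entry i j s).continuousAt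
  refine (intervalIntegral.integral_eq_sub_of_hasDerivAt
    (fun s _ => hasDerivAt_entry (hasDerivAt_mho_mul_sub_mul_exp h s) i j)
    (((continuous_sineFun T k).mul hcont).intervalIntegrable 0 T)).trans ?_
  rw [← Matrix.sub_apply, sineFun_self hT, cosineFun_self hT, sineFun_zero, cosineFun_zero,
    zero_smul, NormedSpace.exp_zero, mul_zero, zero_smul, sub_zero, zero_sub, mul_one, ← mul_sub,
    sub_neg_eq_add, Matrix.smul_mul, mul_comm (freq T k), mul_smul, mul_smul, ← smul_add,
    Matrix.mul_smul]

theorem integral_sineFun (hT : 0 < T) (k : ℕ) :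
    ∫ s in (0 : ℝ)..T, sineFun T k s = √(2 / T) / freq T k := by
  have hω := (freq_pos hT k).ne'
  have hderiv (s : ℝ) : HasDerivAt (fun s => -(cosineFun T k s / freq T k)) (sineFun T k s) s := by
    refine ((hasDerivAt_cosineFun T k s).div_const (freq T k)).neg.congr_deriv ?_
    field_simp
  rw [intervalIntegral.integral_eq_sub_of_hasDerivAt (fun s _ => hderiv s)
    ((continuous_sineFun T k).intervalIntegrable _ _), cosineFun_self hT, cosineFun_zero]
  ring

theorem integral_sineFun_mul_exp_sub_one (h : IsUnit (mhoInv A T k)) (hT : 0 < T) (i j : Fin n) :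
    ∫ s in (0 : ℝ)..T, sineFun T k s *
      (NormedSpace.exp (s • A) i j - (1 : Matrix (Fin n) (Fin n) ℝ) i j) = expCoeff A T k i j := by
  have hcont : Continuous fun s : ℝ => NormedSpace.exp (s • A) i j :=
    continuous_iff_continuousAt.2 fun s => (hasDerivAt_exp_entry i j s).continuousAt
  have hproduct : IntervalIntegrable (fun s => sineFun T k s * NormedSpace.exp (s • A) i j)
      MeasureTheory.volume 0 T := ((continuous_sineFun T k).mul hcont).intervalIntegrable 0 T
  simp only [mul_sub]
  rw [intervalIntegral.integral_sub hproduct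
    (((continuous_sineFun T k).intervalIntegrable 0 T).mul_const _),
    integral_sineFun_mul_exp_entry h hT, intervalIntegral.integral_mul_const, integral_sineFun hT,
    expCoeff_eq hT h]
  rfl

theorem hasSum_sineFun_mul_expCoeff (hA : ∀ k, IsUnit (mhoInv A T k)) (hT : 0 < T) {t : ℝ}
    (ht : t ∈ Set.Icc 0 T) (i j : Fin n) :
    HasSum (fun k => sineFun T k t * expCoeff A T k i j)
      (NormedSpace.exp (t • A) i j - (1 : Matrix (Fin n) (Fin n) ℝ) i j) := by
  have hsum := hasSum_sineFun_mul_integral hT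
    (fun s => (hasDerivAt_exp_entry (A := A) i j s).sub_const
      ((1 : Matrix (Fin n) (Fin n) ℝ) i j))
    (fun s => hasDerivAt_mul_exp_entry A i j s)
    (continuous_iff_continuousAt.2 fun s =>
      (hasDerivAt_mul_exp_entry (A * A) i j s).continuousAt) (by simp) ht
  simpa only [integral_sineFun_mul_exp_sub_one (hA _) hT] using hsum

end Norm

end MatrixCoefficients

section LinearEquation

open MeasureTheory

variable {V : Type*} [NormedAddCommGroup V] [NormedSpace ℝ V] [CompleteSpace V]

theorem eq_zero_of_eq_integral (L : V →L[ℝ] V) {T : ℝ} {d : ℝ → V}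
    (hint : IntervalIntegrable d volume 0 T)
    (hd : ∀ t ∈ Set.Icc 0 T, d t = ∫ s in (0 : ℝ)..t, L (d s)) {t : ℝ} (ht : t ∈ Set.Icc 0 T) :
    d t = 0 := by
  have hT : 0 ≤ T := ht.1.trans ht.2
  have hcont : ContinuousOn d (Set.Icc 0 T) := by
    have h := intervalIntegral.continuousOn_primitive_interval' (f := fun s => L (d s))
      ⟨L.integrable_comp hint.1, L.integrable_comp hint.2⟩ Set.left_mem_uIcc
    rw [Set.uIcc_of_le hT] at h
    exact h.congr hd
  have hcontL : ContinuousOn (fun s => L (d s)) (Set.Icc 0 T) :=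
    L.continuous.comp_continuousOn hcont
  have hderiv : ∀ r ∈ Set.Ico 0 T, HasDerivWithinAt d (L (d r)) (Set.Ici r) r := by
    intro r hr
    have hnhds : nhdsWithin r (Set.Ioi r) ≤ nhdsWithin r (Set.Icc 0 T) :=
      nhdsWithin_le_of_mem (Icc_mem_nhdsGT_of_mem hr)
    have hprim : HasDerivWithinAt (fun u => ∫ s in (0 : ℝ)..u, L (d s)) (L (d r)) (Set.Ici r) r :=
      intervalIntegral.integral_hasDerivWithinAt_right (t := Set.Ioi r)
        (ContinuousOn.intervalIntegrable_of_Icc hr.1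
          (hcontL.mono (Set.Icc_subset_Icc_right hr.2.le)))
        ((hcontL.stronglyMeasurableAtFilter_nhdsWithin measurableSet_Icc r).filter_mono hnhds)
        ((hcontL r ⟨hr.1, hr.2.le⟩).mono_left hnhds)
    refine hprim.congr_of_eventuallyEq ?_ (hd r ⟨hr.1, hr.2.le⟩)
    filter_upwards [Icc_mem_nhdsGE_of_mem hr] with u hu using hd u hu
  refine eq_zero_of_abs_deriv_le_mul_abs_self_of_eq_zero_right (K := ‖L‖) hcont hderiv ?_
    (fun r _ => L.le_opNorm _) t ht
  simpa using hd 0 ⟨le_rfl, hT⟩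

theorem eq_of_eq_add_integral (L : V →L[ℝ] V) {T : ℝ} {g x y : ℝ → V}
    (hxint : IntervalIntegrable x volume 0 T) (hyint : IntervalIntegrable y volume 0 T)
    (hx : ∀ t ∈ Set.Icc 0 T, x t = g t + ∫ s in (0 : ℝ)..t, L (x s))
    (hy : ∀ t ∈ Set.Icc 0 T, y t = g t + ∫ s in (0 : ℝ)..t, L (y s)) {t : ℝ}
    (ht : t ∈ Set.Icc 0 T) : x t = y t := by
  refine sub_eq_zero.1 (eq_zero_of_eq_integral L (hxint.sub hyint) (fun t ht => ?_) ht)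
  have hsub : Set.uIcc 0 t ⊆ Set.uIcc 0 T := by
    rw [Set.uIcc_of_le ht.1, Set.uIcc_of_le (ht.1.trans ht.2)]
    exact Set.Icc_subset_Icc_right ht.2
  have hL {z : ℝ → V} (hz : IntervalIntegrable z volume 0 T) :
      IntervalIntegrable (fun s => L (z s)) volume 0 t :=
    ⟨L.integrable_comp (hz.mono_set hsub).1, L.integrable_comp (hz.mono_set hsub).2⟩
  simp only [map_sub]
  rw [intervalIntegral.integral_sub (hL hxint) (hL hyint), hx t ht, hy t ht,
    add_sub_add_left_eq_sub]

variable {ι : Type*} [Fintype ι] {H : Type*} [NormedAddCommGroup H] [NormedSpace ℝ H]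

theorem intervalIntegrable_sum_smul {a b : ℝ} (c : ι → ℝ) {y : ℝ → ι → H}
    (hy : ∀ l, IntervalIntegrable (fun s => y s l) volume a b) :
    IntervalIntegrable (fun s => ∑ l, c l • y s l) volume a b :=
  ⟨integrable_finsetSum _ fun l _ => (hy l).1.smul (c l),
    integrable_finsetSum _ fun l _ => (hy l).2.smul (c l)⟩

variable [CompleteSpace H]

theorem eq_of_eq_add_integral_sum (A : Matrix ι ι ℝ) {T : ℝ} {g x y : ℝ → ι → H}
    (hxint : ∀ i, IntervalIntegrable (fun s => x s i) volume 0 T)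
    (hyint : ∀ i, IntervalIntegrable (fun s => y s i) volume 0 T)
    (hx : ∀ t ∈ Set.Icc 0 T, ∀ i, x t i = g t i + ∫ s in (0 : ℝ)..t, ∑ l, A i l • x s l)
    (hy : ∀ t ∈ Set.Icc 0 T, ∀ i, y t i = g t i + ∫ s in (0 : ℝ)..t, ∑ l, A i l • y s l) {t : ℝ}
    (ht : t ∈ Set.Icc 0 T) : x t = y t := by
  let L : (ι → H) →L[ℝ] (ι → H) :=
    ContinuousLinearMap.pi fun i => ∑ l, A i l • ContinuousLinearMap.proj l
  have hL (v : ι → H) (i : ι) : L v i = ∑ l, A i l • v l := by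
    simp [L]
  have hpi {z : ℝ → ι → H} (hz : ∀ i, IntervalIntegrable (fun s => z s i) volume 0 T) :
      IntervalIntegrable z volume 0 T :=
    ⟨Integrable.of_eval fun i => (hz i).1, Integrable.of_eval fun i => (hz i).2⟩
  have heq {z : ℝ → ι → H} (hz : ∀ i, IntervalIntegrable (fun s => z s i) volume 0 T)
      (hzg : ∀ t ∈ Set.Icc 0 T, ∀ i, z t i = g t i + ∫ s in (0 : ℝ)..t, ∑ l, A i l • z s l) :
      ∀ t ∈ Set.Icc 0 T, z t = g t + ∫ s in (0 : ℝ)..t, L (z s) := by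
    intro t ht
    have hzt : IntervalIntegrable (fun s => L (z s)) volume 0 t :=
      have h := (hpi hz).mono_set (Set.uIcc_subset_uIcc Set.left_mem_uIcc
        (Set.Icc_subset_uIcc ht))
      ⟨L.integrable_comp h.1, L.integrable_comp h.2⟩
    funext i
    have h := (ContinuousLinearMap.proj (R := ℝ) (φ := fun _ : ι => H) i).intervalIntegral_comp_comm
      hzt
    simp only [ContinuousLinearMap.proj_apply, hL] at h
    rw [hzg t ht i, Pi.add_apply, h]
  exact eq_of_eq_add_integral L (hpi hxint) (hpi hyint) (heq hxint hx) (heq hyint hy) ht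

end LinearEquation

section FreeMotion

variable {n : ℕ} {H : Type*} [NormedAddCommGroup H] [NormedSpace ℝ H]

theorem hasDerivAt_sum_exp_smul (A : Matrix (Fin n) (Fin n) ℝ) (η : Fin n → H) (i : Fin n)
    (t : ℝ) : HasDerivAt (fun t => ∑ l, NormedSpace.exp (t • A) i l • η l)
      (∑ l, A i l • ∑ m, NormedSpace.exp (t • A) l m • η m) t := by
  refine (HasDerivAt.fun_sum fun l _ =>
    (hasDerivAt_exp_entry i l t).smul_const (η l)).congr_deriv ?_
  simp only [Matrix.mul_apply, Finset.sum_smul, Finset.smul_sum, smul_smul]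
  exact Finset.sum_comm

theorem continuous_sum_exp_smul (A : Matrix (Fin n) (Fin n) ℝ) (η : Fin n → H) (i : Fin n) :
    Continuous fun t : ℝ => ∑ l, NormedSpace.exp (t • A) i l • η l :=
  continuous_iff_continuousAt.2 fun t => (hasDerivAt_sum_exp_smul A η i t).continuousAt

theorem sum_exp_smul_eq_add_integral [CompleteSpace H] (A : Matrix (Fin n) (Fin n) ℝ)
    (η : Fin n → H) (t : ℝ) (i : Fin n) : ∑ l, NormedSpace.exp (t • A) i l • η l =
      η i + ∫ s in (0 : ℝ)..t, ∑ l, A i l • ∑ m, NormedSpace.exp (s • A) l m • η m := by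
  have hcont : Continuous fun s : ℝ => ∑ l, A i l • ∑ m, NormedSpace.exp (s • A) l m • η m :=
    continuous_finsetSum _ fun l _ => (continuous_sum_exp_smul A η l).const_smul (A i l)
  rw [intervalIntegral.integral_eq_sub_of_hasDerivAt
    (fun s _ => hasDerivAt_sum_exp_smul A η i s) (hcont.intervalIntegrable 0 t)]
  simp [Matrix.one_apply, ite_smul]

end FreeMotion

section ForcedSolution

open MeasureTheory Filter

variable {F : Type*} [NormedAddCommGroup F] [InnerProductSpace ℂ F]

theorem summable_real_smul_of_orthonormal [CompleteSpace F] {ι : Type*} {e : ι → F}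
    (he : Orthonormal ℂ e) {c : ι → ℝ} (hc : Summable fun k => c k ^ 2) :
    Summable fun k => c k • e k :=
  (he.orthogonalFamily.summable_iff_norm_sq_summable fun k => (c k : ℂ)).2 (by simpa using hc)

theorem norm_sum_real_smul_le_of_orthonormal {ι : Type*} {e : ι → F} (he : Orthonormal ℂ e)
    {c u : ι → ℝ} (hu : Summable u) (hcu : ∀ k, c k ^ 2 ≤ u k) (s : Finset ι) :
    ‖∑ k ∈ s, c k • e k‖ ≤ √(∑' k, u k) := by
  have hnorm : ‖∑ k ∈ s, c k • e k‖ ^ 2 = ∑ k ∈ s, c k ^ 2 := by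
    simpa using he.orthogonalFamily.norm_sum (fun k => (c k : ℂ)) s
  refine Real.le_sqrt_of_sq_le (hnorm.trans_le ?_)
  exact (Finset.sum_le_sum fun k _ => hcu k).trans
    (hu.sum_le_tsum s fun k _ => (sq_nonneg _).trans (hcu k))

section KarhunenLoeveCombinations

variable {ι ι' κ : Type*} [Fintype ι'] [Fintype κ] {b : κ → ℝ → F} {T : ℝ}

/-- The vector `∑ⱼ Kᵢⱼ eₖʲ`, where `eₖʲ` are the Karhunen-Loeve coefficients of the curves `b j`:
the `i`-th entry of the product of the matrix `K` and the vector of these coefficients. -/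
def klComb (b : κ → ℝ → F) (T : ℝ) (K : Matrix ι κ ℝ) (k : ℕ) (i : ι) : F :=
  ∑ j, K i j • klVec (b j) T k

theorem klComb_sub (K K' : Matrix ι κ ℝ) (k : ℕ) (i : ι) :
    klComb b T (K - K') k i = klComb b T K k i - klComb b T K' k i := by
  simp [klComb, sub_smul, Finset.sum_sub_distrib]

theorem klComb_smul (r : ℝ) (K : Matrix ι κ ℝ) (k : ℕ) (i : ι) :
    klComb b T (r • K) k i = r • klComb b T K k i := by
  simp [klComb, Finset.smul_sum, smul_smul]

theorem klComb_mul (A : Matrix ι ι' ℝ) (K : Matrix ι' κ ℝ) (k : ℕ) (i : ι) :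
    klComb b T (A * K) k i = ∑ l, A i l • klComb b T K k l := by
  simp only [klComb, Matrix.mul_apply, Finset.sum_smul, Finset.smul_sum, smul_smul]
  exact Finset.sum_comm

theorem hasSum_klComb [CompleteSpace F] (hb : ∀ j, IsWienerCurve (b j)) (hT : 0 < T) {t : ℝ}
    (ht : t ∈ Set.Icc 0 T) (B : Matrix ι κ ℝ) (i : ι) :
    HasSum (fun k => (sineFun T k t / freq T k) • klComb b T B k i) (∑ j, B i j • b j t) := by
  have hsum : HasSum (fun k => ∑ j, B i j • (sineFun T k t / freq T k) • klVec (b j) T k)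
      (∑ j, B i j • b j t) :=
    hasSum_sum fun j _ => ((hb j).hasSum_klVec hT ht).const_smul (B i j)
  refine hsum.congr_fun fun k => ?_
  rw [klComb, Finset.smul_sum]
  exact Finset.sum_congr rfl fun j _ => smul_comm _ _ _

end KarhunenLoeveCombinations

variable {n : ℕ} {κ : Type*} [Fintype κ] {b : κ → ℝ → F} {T : ℝ}
  {A : Matrix (Fin n) (Fin n) ℝ} {B : Matrix (Fin n) κ ℝ}

/-- The `k`-th term `f_k(t) ω_k ℧_k B e_k - g_k(t) A ℧_k B e_k` of the forced solution, where `e_k`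
is the vector of the `k`-th Karhunen-Loeve coefficients of the curves `b j`. -/
def forcedTerm (b : κ → ℝ → F) (A : Matrix (Fin n) (Fin n) ℝ) (B : Matrix (Fin n) κ ℝ) (T : ℝ)
    (k : ℕ) (t : ℝ) (i : Fin n) : F :=
  sineFun T k t • klComb b T (freq T k • (mho A T k * B)) k i
    - cosineFun T k t • klComb b T (A * mho A T k * B) k i

/-- The forced solution: the part of the solution of `dx = A x dt + B db` that remains when the
free motion `exp (t A) ξ` is split off, for the initial value `ξ` of the expansion. -/
def forcedSol (b : κ → ℝ → F) (A : Matrix (Fin n) (Fin n) ℝ) (B : Matrix (Fin n) κ ℝ) (T t : ℝ)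
    (i : Fin n) : F := ∑' k, forcedTerm b A B T k t i

theorem forcedTerm_eq_sum (k : ℕ) (t : ℝ) (i : Fin n) : forcedTerm b A B T k t i =
    ∑ j, (sineFun T k t * (freq T k • (mho A T k * B)) i j
      - cosineFun T k t * (A * mho A T k * B) i j) • klVec (b j) T k := by
  simp only [forcedTerm, klComb, sub_smul, Finset.sum_sub_distrib, mul_smul, Finset.smul_sum]

theorem forcedTerm_zero (k : ℕ) (i : Fin n) :
    forcedTerm b A B T k 0 i = -(√(2 / T) • klComb b T (A * mho A T k * B) k i) := by
  rw [forcedTerm, sineFun_zero, cosineFun_zero, zero_smul, zero_sub]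

theorem sq_sineFun_mul_sub_cosineFun_mul_le (hT : 0 < T) (k : ℕ) (t p q : ℝ) :
    (sineFun T k t * p - cosineFun T k t * q) ^ 2 ≤ 2 / T * (p ^ 2 + q ^ 2) := by
  rw [← sineFun_sq_add_cosineFun_sq hT k t]
  linarith [sq_nonneg (sineFun T k t * q + cosineFun T k t * p)]

theorem summable_forcedTerm_bound (hA : ∀ k, IsUnit (mhoInv A T k)) (hT : 0 < T) (i : Fin n)
    (j : κ) : Summable fun k =>
      2 / T * ((freq T k • (mho A T k * B)) i j ^ 2 + (A * mho A T k * B) i j ^ 2) :=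
  ((summable_sq_freq_smul_mho_mul hA hT B i j).add
    (summable_sq_mul_mho_mul hA hT A B i j)).mul_left _

theorem continuous_forcedTerm (k : ℕ) (i : Fin n) :
    Continuous fun t => forcedTerm b A B T k t i :=
  ((continuous_sineFun T k).smul continuous_const).sub
    ((continuous_cosineFun T k).smul continuous_const)

theorem hasDerivAt_forcedTerm_sub (hA : ∀ k, IsUnit (mhoInv A T k)) (hT : 0 < T) (k : ℕ) (t : ℝ)
    (i : Fin n) :
    HasDerivAt (fun t => forcedTerm b A B T k t i - (sineFun T k t / freq T k) • klComb b T B k i)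
      (∑ l, A i l • forcedTerm b A B T k t l) t := by
  have hω := (freq_pos hT k).ne'
  have hderiv := (((hasDerivAt_sineFun T k t).smul_const
    (klComb b T (freq T k • (mho A T k * B)) k i)).sub
    ((hasDerivAt_cosineFun T k t).smul_const (klComb b T (A * mho A T k * B) k i))).sub
    (((hasDerivAt_sineFun T k t).div_const (freq T k)).smul_const (klComb b T B k i))
  refine hderiv.congr_deriv ?_
  have hfreq : freq T k • (freq T k • (mho A T k * B)) = B - A * (A * mho A T k * B) := by
    rw [smul_smul, ← sq, ← Matrix.smul_mul, freq_sq_smul_mho (hA k), Matrix.sub_mul,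
      Matrix.one_mul, Matrix.mul_assoc A (A * mho A T k)]
  have hdrift : A * (freq T k • (mho A T k * B)) = freq T k • (A * mho A T k * B) := by
    rw [Matrix.mul_smul, Matrix.mul_assoc]
  simp only [forcedTerm, smul_sub, Finset.sum_sub_distrib, smul_comm (A i _) (sineFun T k t),
    smul_comm (A i _) (cosineFun T k t), ← Finset.smul_sum, ← klComb_mul, hdrift]
  rw [mul_comm (freq T k), mul_smul, ← klComb_smul, hfreq, klComb_sub, klComb_smul (freq T k)
    (A * mho A T k * B), mul_div_cancel_right₀ _ hω]
  module

theorem sum_forcedTerm_sub_eq (hA : ∀ k, IsUnit (mhoInv A T k)) (hT : 0 < T) [CompleteSpace F]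
    (t : ℝ) (i : Fin n) (s : Finset ℕ) :
    ∑ k ∈ s, forcedTerm b A B T k t i - ∑ k ∈ s, forcedTerm b A B T k 0 i =
      (∫ r in (0 : ℝ)..t, ∑ l, A i l • ∑ k ∈ s, forcedTerm b A B T k r l)
        + ∑ k ∈ s, (sineFun T k t / freq T k) • klComb b T B k i := by
  have hderiv (r : ℝ) : HasDerivAt (fun t => ∑ k ∈ s, (forcedTerm b A B T k t i
      - (sineFun T k t / freq T k) • klComb b T B k i))
      (∑ l, A i l • ∑ k ∈ s, forcedTerm b A B T k r l) r := by
    refine (HasDerivAt.fun_sum fun k _ => hasDerivAt_forcedTerm_sub hA hT k r i).congr_deriv ?_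
    simp only [Finset.smul_sum]
    exact Finset.sum_comm
  have hcont : Continuous fun r => ∑ l, A i l • ∑ k ∈ s, forcedTerm b A B T k r l :=
    continuous_finsetSum _ fun l _ =>
      (continuous_finsetSum s fun k _ => continuous_forcedTerm k l).const_smul _
  rw [intervalIntegral.integral_eq_sub_of_hasDerivAt (fun r _ => hderiv r)
    (hcont.intervalIntegrable 0 t)]
  simp only [Finset.sum_sub_distrib, sineFun_zero, zero_div, zero_smul, Finset.sum_const_zero]
  abel

variable [CompleteSpace F] (hb : ∀ j, IsWienerCurve (b j)) (hA : ∀ k, IsUnit (mhoInv A T k))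
  (hT : 0 < T)

include hb hA hT

theorem summable_forcedTerm (t : ℝ) (i : Fin n) : Summable fun k => forcedTerm b A B T k t i := by
  simp only [forcedTerm_eq_sum]
  refine summable_sum fun j _ => summable_real_smul_of_orthonormal ((hb j).orthonormal_klVec hT) ?_
  exact Summable.of_nonneg_of_le (fun k => sq_nonneg _)
    (fun k => sq_sineFun_mul_sub_cosineFun_mul_le hT k t _ _) (summable_forcedTerm_bound hA hT i j)

theorem hasSum_forcedTerm (t : ℝ) (i : Fin n) :
    HasSum (fun k => forcedTerm b A B T k t i) (forcedSol b A B T t i) :=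
  (summable_forcedTerm hb hA hT t i).hasSum

theorem exists_norm_sum_forcedTerm_le (B : Matrix (Fin n) κ ℝ) (i : Fin n) :
    ∃ C : ℝ, ∀ (s : Finset ℕ) (t : ℝ), ‖∑ k ∈ s, forcedTerm b A B T k t i‖ ≤ C := by
  refine ⟨∑ j, √(∑' k, 2 / T *
    ((freq T k • (mho A T k * B)) i j ^ 2 + (A * mho A T k * B) i j ^ 2)), fun s t => ?_⟩
  simp only [forcedTerm_eq_sum]
  rw [Finset.sum_comm]
  exact (norm_sum_le _ _).trans (Finset.sum_le_sum fun j _ =>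
    norm_sum_real_smul_le_of_orthonormal ((hb j).orthonormal_klVec hT)
      (summable_forcedTerm_bound hA hT i j)
      (fun k => sq_sineFun_mul_sub_cosineFun_mul_le hT k t _ _) s)

theorem intervalIntegrable_forcedSol (B : Matrix (Fin n) κ ℝ) (i : Fin n) (x y : ℝ) :
    IntervalIntegrable (fun t => forcedSol b A B T t i) volume x y := by
  obtain ⟨C, hC⟩ := exists_norm_sum_forcedTerm_le hb hA hT B i
  have hlim (t : ℝ) : Tendsto (fun s : Finset ℕ => ∑ k ∈ s, forcedTerm b A B T k t i) atTop
      (nhds (forcedSol b A B T t i)) := hasSum_forcedTerm hb hA hT t i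
  have hmeas : AEStronglyMeasurable (fun t => forcedSol b A B T t i) volume :=
    aestronglyMeasurable_of_tendsto_ae atTop
      (f := fun (s : Finset ℕ) t => ∑ k ∈ s, forcedTerm b A B T k t i)
      (fun s => (continuous_finsetSum s fun k _ => continuous_forcedTerm k i).aestronglyMeasurable)
      (Eventually.of_forall hlim)
  refine (intervalIntegrable_const (c := C)).mono_fun hmeas.restrict
    (Eventually.of_forall fun t => ?_)
  exact (le_of_tendsto' (hlim t).norm fun s => hC s t).trans (le_abs_self C)

theorem tendsto_integral_sum_forcedTerm (B : Matrix (Fin n) κ ℝ) (t : ℝ) (i : Fin n) :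
    Tendsto (fun s : Finset ℕ => ∫ r in (0 : ℝ)..t, ∑ l, A i l • ∑ k ∈ s, forcedTerm b A B T k r l)
      atTop (nhds (∫ r in (0 : ℝ)..t, ∑ l, A i l • forcedSol b A B T r l)) := by
  choose C hC using exists_norm_sum_forcedTerm_le hb hA hT B
  refine intervalIntegral.tendsto_integral_filter_of_dominated_convergence
    (fun _ => ∑ l, |A i l| * C l) (Eventually.of_forall fun s => ?_)
    (Eventually.of_forall fun s => Eventually.of_forall fun r _ => ?_)
    intervalIntegrable_const (Eventually.of_forall fun r _ => ?_)
  · exact (continuous_finsetSum _ fun l _ => (continuous_finsetSum s fun k _ =>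
      continuous_forcedTerm k l).const_smul _).aestronglyMeasurable
  · refine (norm_sum_le _ _).trans (Finset.sum_le_sum fun l _ => ?_)
    rw [norm_smul, Real.norm_eq_abs]
    exact mul_le_mul_of_nonneg_left (hC l s r) (abs_nonneg _)
  · exact tendsto_finsetSum _ fun l _ =>
      Tendsto.const_smul (hasSum_forcedTerm hb hA hT r l) (A i l)

theorem forcedSol_eq_add_integral (B : Matrix (Fin n) κ ℝ) {t : ℝ} (ht : t ∈ Set.Icc 0 T)
    (i : Fin n) : forcedSol b A B T t i = forcedSol b A B T 0 i
      + ∑ j, B i j • b j t + ∫ s in (0 : ℝ)..t, ∑ l, A i l • forcedSol b A B T s l := by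
  have hlim := (tendsto_integral_sum_forcedTerm hb hA hT B t i).add (hasSum_klComb hb hT ht B i)
  have hdiff := (hasSum_forcedTerm (B := B) hb hA hT t i).sub
    (hasSum_forcedTerm (B := B) hb hA hT 0 i)
  have heq : forcedSol b A B T t i - forcedSol b A B T 0 i =
      (∫ s in (0 : ℝ)..t, ∑ l, A i l • forcedSol b A B T s l) + ∑ j, B i j • b j t := by
    refine tendsto_nhds_unique hdiff (hlim.congr fun s => ?_)
    rw [← sum_forcedTerm_sub_eq hA hT, Finset.sum_sub_distrib]
  rw [add_assoc, add_comm (∑ j, _), ← heq, add_sub_cancel]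

variable {H : Type*} [NormedAddCommGroup H] [NormedSpace ℝ H] [CompleteSpace H]

theorem map_forcedSol_eq_add_integral (L : F →L[ℝ] H) (B : Matrix (Fin n) κ ℝ) {t : ℝ}
    (ht : t ∈ Set.Icc 0 T) (i : Fin n) :
    L (forcedSol b A B T t i) = L (forcedSol b A B T 0 i) + ∑ j, B i j • L (b j t)
      + ∫ s in (0 : ℝ)..t, ∑ l, A i l • L (forcedSol b A B T s l) := by
  have hint := intervalIntegrable_sum_smul (A i)
    fun l => intervalIntegrable_forcedSol hb hA hT B l 0 t
  rw [forcedSol_eq_add_integral hb hA hT B ht i, map_add, map_add,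
    ← L.intervalIntegral_comp_comm hint]
  simp only [map_sum, map_smul]

theorem eq_exp_add_forcedSol (L : F →L[ℝ] H) {x₀ η : Fin n → H}
    (hη : ∀ i, η i = x₀ i - L (forcedSol b A B T 0 i)) {x : ℝ → Fin n → H}
    (hxint : ∀ i, IntervalIntegrable (fun s => x s i) volume 0 T)
    (hx : ∀ t ∈ Set.Icc 0 T, ∀ i, x t i = x₀ i + ∑ j, B i j • L (b j t)
      + ∫ s in (0 : ℝ)..t, ∑ l, A i l • x s l) {t : ℝ} (ht : t ∈ Set.Icc 0 T) (i : Fin n) :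
    x t i = ∑ l, NormedSpace.exp (t • A) i l • η l + L (forcedSol b A B T t i) := by
  have hfree (i : Fin n) : IntervalIntegrable
      (fun s => ∑ l, NormedSpace.exp (s • A) i l • η l) volume 0 T :=
    (continuous_sum_exp_smul A η i).intervalIntegrable 0 T
  have hforced (i : Fin n) : IntervalIntegrable (fun s => L (forcedSol b A B T s i)) volume 0 T :=
    have hint := intervalIntegrable_forcedSol hb hA hT B i 0 T
    ⟨L.integrable_comp hint.1, L.integrable_comp hint.2⟩
  refine congrFun (eq_of_eq_add_integral_sum A (x := x) (y := fun t i =>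
    ∑ l, NormedSpace.exp (t • A) i l • η l + L (forcedSol b A B T t i))
    hxint (fun i => (hfree i).add (hforced i)) hx (fun s hs k => ?_) ht) i
  have hsub : Set.uIcc 0 s ⊆ Set.uIcc 0 T := by
    rw [Set.uIcc_of_le hs.1, Set.uIcc_of_le hT.le]
    exact Set.Icc_subset_Icc_right hs.2
  simp only [smul_add, Finset.sum_add_distrib]
  rw [intervalIntegral.integral_add
    (intervalIntegrable_sum_smul (A k) fun l => (hfree l).mono_set hsub)
    (intervalIntegrable_sum_smul (A k) fun l => (hforced l).mono_set hsub),
    sum_exp_smul_eq_add_integral A η s k, map_forcedSol_eq_add_integral hb hA hT L B hs k, hη]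
  abel

end ForcedSolution

section Oscillator

variable {μ n : ℕ} {H₀ : Type*} [NormedAddCommGroup H₀] [InnerProductSpace ℂ H₀]
  {X₀ : Fin n → H₀ →ₗ.[ℂ] H₀} {Θ : Matrix (Fin n) (Fin n) ℝ}

theorem fieldCLM_smul {E : Type*} [NormedAddCommGroup E] [InnerProductSpace ℂ E]
    (P : Submodule ℂ H₀) (ψ : tensorDomain E P) (r : ℝ) (h : E) :
    fieldCLM P ψ (r • h) = (r : ℂ) • fieldCLM P ψ h :=
  (fieldCLM P ψ).map_smul r h

theorem fieldCLM_forcedTerm {E κ : Type*} [NormedAddCommGroup E] [InnerProductSpace ℂ E]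
    [CompleteSpace E] [Fintype κ] (P : Submodule ℂ H₀) (ψ : tensorDomain E P) (b : κ → ℝ → E)
    (A : Matrix (Fin n) (Fin n) ℝ) (B : Matrix (Fin n) κ ℝ) (T : ℝ) (k : ℕ) (t : ℝ) (i : Fin n) :
    fieldCLM P ψ (forcedTerm b A B T k t i)
      = (sineFun T k t : ℂ) • fieldCLM P ψ (klComb b T (freq T k • (mho A T k * B)) k i)
        - (cosineFun T k t : ℂ) • fieldCLM P ψ (klComb b T (A * mho A T k * B) k i) := by
  rw [forcedTerm, map_sub, fieldCLM_smul, fieldCLM_smul]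

theorem opMulVec_apply {ι κ H : Type*} [Fintype κ] [AddCommGroup H] [Module ℂ H]
    {D : Submodule ℂ H} (K : Matrix ι κ ℝ) (V : κ → (D →ₗ[ℂ] H)) (i : ι) (ψ : D) :
    opMulVec K V i ψ = ∑ j, (K i j : ℂ) • V j ψ := by
  rw [opMulVec, LinearMap.sum_apply]
  rfl

section Domain

variable (ψ : tensorDomain (OneParticle μ) (initialDomain X₀))

theorem wiener_apply_sub (t : ℝ) (j : Fin 2 × Fin μ) :
    wiener X₀ t j ψ - ψ = fieldCLM _ ψ (wienerTest t j) := by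
  simp [wiener, fieldCLM_apply]

theorem wiener_sub_wiener_zero_apply (t : ℝ) (j : Fin 2 × Fin μ) :
    (wiener X₀ t j - wiener X₀ 0 j) ψ = fieldCLM _ ψ (wienerTest t j) := by
  have hzero : wienerTest 0 j = 0 := by
    simpa using (isWienerCurve_wienerTest j).norm_sq le_rfl
  rw [LinearMap.sub_apply, ← sub_sub_sub_cancel_right _ _ (ψ : SystemFieldSpace H₀ _),
    wiener_apply_sub, wiener_apply_sub, hzero, map_zero, sub_zero]

theorem qklCoeff_apply (T : ℝ) (k : ℕ) (j : Fin 2 × Fin μ) :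
    qklCoeff X₀ T k j ψ = fieldCLM _ ψ (klVec (fun t => wienerTest t j) T k) := by
  rw [klVec_map (continuous_wienerTest j)]
  change (freq T k : ℂ) • ∫ t in (0 : ℝ)..T, (sineFun T k t : ℂ) • (wiener X₀ t j ψ - ψ) = _
  simp only [wiener_apply_sub]
  rfl

theorem opMulVec_qklCoeff_apply {ι : Type*} (K : Matrix ι (Fin 2 × Fin μ) ℝ) (T : ℝ) (k : ℕ)
    (i : ι) : opMulVec K (qklCoeff X₀ T k) i ψ
      = fieldCLM _ ψ (klComb (fun j t => wienerTest t j) T K k i) := by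
  simp only [opMulVec_apply, qklCoeff_apply, klComb, map_sum, fieldCLM_smul]

end Domain

namespace IsFieldAffine

theorem of_apply {S : DomainOp μ X₀} (h : OneParticle μ) (hS : ∀ ψ, S ψ = fieldCLM _ ψ h) :
    IsFieldAffine S :=
  ⟨0, h, fun ψ => by simp [hS]⟩

theorem initialOp (j : Fin n) : IsFieldAffine (initialOp μ X₀ j) :=
  ⟨Pi.single j 1, 0, fun ψ => by simp [Pi.single_apply, ite_smul]⟩

theorem add {S S' : DomainOp μ X₀} (hS : IsFieldAffine S) (hS' : IsFieldAffine S') :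
    IsFieldAffine (S + S') := by
  obtain ⟨a, h, hS⟩ := hS
  obtain ⟨a', h', hS'⟩ := hS'
  refine ⟨a + a', h + h', fun ψ => ?_⟩
  simp only [LinearMap.add_apply, hS, hS', Pi.add_apply, Complex.ofReal_add, add_smul,
    Finset.sum_add_distrib, map_add]
  abel

theorem smul (r : ℝ) {S : DomainOp μ X₀} (hS : IsFieldAffine S) :
    IsFieldAffine ((r : ℂ) • S) := by
  obtain ⟨a, h, hS⟩ := hS
  refine ⟨r • a, r • h, fun ψ => ?_⟩
  simp only [LinearMap.smul_apply, hS, Pi.smul_apply, smul_eq_mul, Complex.ofReal_mul, mul_smul,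
    smul_add, Finset.smul_sum]
  exact congrArg _ (fieldCLM_smul _ ψ r h).symm

theorem neg {S : DomainOp μ X₀} (hS : IsFieldAffine S) : IsFieldAffine (-S) := by
  simpa using hS.smul (-1)

theorem sum {ι : Type*} (s : Finset ι) {S : ι → DomainOp μ X₀} (hS : ∀ j, IsFieldAffine (S j)) :
    IsFieldAffine (∑ j ∈ s, S j) := by
  classical
  induction s using Finset.induction_on with
  | empty => exact of_apply 0 fun ψ => by simp
  | insert j s hj ih =>
    rw [Finset.sum_insert hj]
    exact (hS j).add ih

theorem opMulVec {ι κ : Type*} [Fintype κ] (K : Matrix ι κ ℝ) {V : κ → DomainOp μ X₀}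
    (hV : ∀ j, IsFieldAffine (V j)) (i : ι) : IsFieldAffine (opMulVec K V i) :=
  sum _ fun j => (hV j).smul (K i j)

theorem opMulVec_qklCoeff {ι : Type*} (K : Matrix ι (Fin 2 × Fin μ) ℝ) (T : ℝ) (k : ℕ) (i : ι) :
    IsFieldAffine (_root_.opMulVec K (qklCoeff X₀ T k) i) :=
  of_apply _ fun ψ => opMulVec_qklCoeff_apply ψ K T k i

end IsFieldAffine

variable {A : Matrix (Fin n) (Fin n) ℝ} {B : Matrix (Fin n) (Fin 2 × Fin μ) ℝ} {T : ℝ}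

/-- The vector `ξ` of the expansion: the initial variables without the value at time zero of the
forced solution. -/
def klInitial (X₀ : Fin n → H₀ →ₗ.[ℂ] H₀) (A : Matrix (Fin n) (Fin n) ℝ)
    (B : Matrix (Fin n) (Fin 2 × Fin μ) ℝ) (T : ℝ) (i : Fin n) : DomainOp μ X₀ :=
  initialOp μ X₀ i - fieldAmpl _ (fieldOp (forcedSol (fun j t => wienerTest t j) A B T 0 i))

theorem klInitial_apply (i : Fin n) (ψ : tensorDomain (OneParticle μ) (initialDomain X₀)) :
    klInitial X₀ A B T i ψ = initialOp μ X₀ i ψ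
      - fieldCLM _ ψ (forcedSol (fun j t => wienerTest t j) A B T 0 i) := rfl

theorem isFieldAffine_klInitial (i : Fin n) : IsFieldAffine (klInitial X₀ A B T i) := by
  rw [klInitial, sub_eq_add_neg]
  exact (IsFieldAffine.initialOp i).add (IsFieldAffine.of_apply _ fun ψ => rfl).neg

theorem hasSum_klInitial (hA : ∀ k, IsUnit (mhoInv A T k)) (hT : 0 < T) (i : Fin n)
    (ψ : tensorDomain (OneParticle μ) (initialDomain X₀)) : HasSum
      (fun k => (√(2 / T) : ℂ) • opMulVec (A * mho A T k * B) (qklCoeff X₀ T k) i ψ)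
      (klInitial X₀ A B T i ψ - initialOp μ X₀ i ψ) := by
  rw [klInitial_apply, sub_sub_cancel_left]
  refine ((hasSum_forcedTerm isWienerCurve_wienerTest hA hT 0 i).mapL (fieldCLM _ ψ)).neg.congr_fun
    fun k => ?_
  rw [opMulVec_qklCoeff_apply, forcedTerm_zero, map_neg, neg_neg, fieldCLM_smul]

variable {X : ℝ → Fin n → DomainOp μ X₀}

theorem IsQSDESolution.eq_opMulVec_exp_add (hX : IsQSDESolution A B X₀ X)
    (hA : ∀ k, IsUnit (mhoInv A T k)) (hT : 0 < T) {t : ℝ} (ht : t ∈ Set.Icc 0 T) (i : Fin n) :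
    X t i = opMulVec (NormedSpace.exp (t • A)) (klInitial X₀ A B T) i
      + fieldAmpl _ (fieldOp (forcedSol (fun j t => wienerTest t j) A B T t i)) := by
  refine LinearMap.ext fun ψ => ?_
  rw [LinearMap.add_apply, opMulVec_apply]
  refine eq_exp_add_forcedSol isWienerCurve_wienerTest hA hT (fieldCLM _ ψ)
    (fun i => klInitial_apply i ψ) (x := fun t i => X t i ψ)
    (fun i => hX.intervalIntegrable T hT.le i ψ) (fun s hs k => ?_) ht i
  rw [hX.integral_eq s hs.1 k ψ, add_right_comm]
  simp only [opMulVec_apply, wiener_sub_wiener_zero_apply]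
  rfl

theorem IsQSDESolution.isFieldAffine (hX : IsQSDESolution A B X₀ X)
    (hA : ∀ k, IsUnit (mhoInv A T k)) (hT : 0 < T) {t : ℝ} (ht : t ∈ Set.Icc 0 T) (i : Fin n) :
    IsFieldAffine (X t i) := by
  rw [hX.eq_opMulVec_exp_add hA hT ht i]
  exact (IsFieldAffine.opMulVec _ isFieldAffine_klInitial i).add
    (IsFieldAffine.of_apply _ fun ψ => rfl)

theorem hasSum_sineFun_smul_opMulVec_expCoeff (hA : ∀ k, IsUnit (mhoInv A T k)) (hT : 0 < T)
    {t : ℝ} (ht : t ∈ Set.Icc 0 T) (V : Fin n → DomainOp μ X₀) (i : Fin n)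
    (ψ : tensorDomain (OneParticle μ) (initialDomain X₀)) :
    HasSum (fun k => (sineFun T k t : ℂ) • opMulVec (expCoeff A T k) V i ψ)
      (opMulVec (NormedSpace.exp (t • A)) V i ψ - V i ψ) := by
  have hsum : HasSum (fun k => ∑ l, ((sineFun T k t * expCoeff A T k i l : ℝ) : ℂ) • V l ψ)
      (∑ l, ((NormedSpace.exp (t • A) i l - (1 : Matrix (Fin n) (Fin n) ℝ) i l : ℝ) : ℂ)
        • V l ψ) :=
    hasSum_sum fun l _ =>
      (Complex.hasSum_ofReal.2 (hasSum_sineFun_mul_expCoeff hA hT ht i l)).smul_const (V l ψ)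
  convert hsum using 1
  · simp only [opMulVec_apply, Finset.smul_sum, smul_smul, Complex.ofReal_mul]
  · simp [opMulVec_apply, sub_smul, Finset.sum_sub_distrib, Matrix.one_apply, ite_smul]

theorem IsQSDESolution.hasSum_sub_klInitial (hX : IsQSDESolution A B X₀ X)
    (hA : ∀ k, IsUnit (mhoInv A T k)) (hT : 0 < T) {t : ℝ} (ht : t ∈ Set.Icc 0 T) (i : Fin n)
    (ψ : tensorDomain (OneParticle μ) (initialDomain X₀)) : HasSum
      (fun k => (sineFun T k t : ℂ) • (opMulVec (expCoeff A T k) (klInitial X₀ A B T)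
          + opMulVec (freq T k • (mho A T k * B)) (qklCoeff X₀ T k)) i ψ
        + (cosineFun T k t : ℂ) • (-opMulVec (A * mho A T k * B) (qklCoeff X₀ T k)) i ψ)
      (X t i ψ - klInitial X₀ A B T i ψ) := by
  rw [hX.eq_opMulVec_exp_add hA hT ht i, LinearMap.add_apply, add_sub_right_comm]
  refine ((hasSum_sineFun_smul_opMulVec_expCoeff hA hT ht _ i ψ).add
    ((hasSum_forcedTerm isWienerCurve_wienerTest hA hT t i).mapL (fieldCLM _ ψ))).congr_fun
    fun k => ?_
  simp only [fieldCLM_forcedTerm, Pi.add_apply, Pi.neg_apply, LinearMap.add_apply,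
    LinearMap.neg_apply, opMulVec_qklCoeff_apply, smul_add, smul_neg, add_assoc, sub_eq_add_neg]

end Oscillator

end

theorem theorem2_general {n μ : ℕ}
    {H₀ : Type*} [NormedAddCommGroup H₀] [InnerProductSpace ℂ H₀] [CompleteSpace H₀]
    (Θ A : Matrix (Fin n) (Fin n) ℝ) (hΘ : Θᵀ = -Θ) (B : Matrix (Fin n) (Fin 2 × Fin μ) ℝ)
    (X₀ : Fin n → H₀ →ₗ.[ℂ] H₀) (hX₀ : SatisfiesWeylCCR Θ X₀)
    (X : ℝ → Fin n → DomainOp μ X₀) (hX : IsQSDESolution A B X₀ X)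
    (T : ℝ) (hT : 0 < T) (hA : ∀ k, IsUnit (mhoInv A T k)) :
    ∃ ξ : Fin n → DomainOp μ X₀,
      (∀ i ψ, HasSum
        (fun k => (√(2 / T) : ℂ) • opMulVec (A * mho A T k * B) (qklCoeff X₀ T k) i ψ)
        (ξ i ψ - initialOp μ X₀ i ψ)) ∧
      (∀ i, IsQuantumVariable (ξ i)) ∧
      ∃ α β : ℕ → Fin n → DomainOp μ X₀,
        (∀ k, α k = opMulVec (expCoeff A T k) ξ
          + opMulVec (freq T k • (mho A T k * B)) (qklCoeff X₀ T k)) ∧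
        (∀ k, β k = -opMulVec (A * mho A T k * B) (qklCoeff X₀ T k)) ∧
        (∀ k i, IsQuantumVariable (α k i) ∧ IsQuantumVariable (β k i)) ∧
        ∀ t ∈ Set.Icc 0 T, ∀ i,
          IsQuantumVariable (X t i) ∧
          ∀ ψ, HasSum
            (fun k => (sineFun T k t : ℂ) • α k i ψ + (cosineFun T k t : ℂ) • β k i ψ)
            (X t i ψ - ξ i ψ) := by
  refine ⟨klInitial X₀ A B T, hasSum_klInitial hA hT,
    fun i => (isFieldAffine_klInitial i).isQuantumVariable hΘ hX₀, _, _, fun _ => rfl,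
    fun _ => rfl, fun k i => ⟨?_, ?_⟩, fun t ht i =>
      ⟨(hX.isFieldAffine hA hT ht i).isQuantumVariable hΘ hX₀,
        hX.hasSum_sub_klInitial hA hT ht i⟩⟩
  · exact ((IsFieldAffine.opMulVec _ isFieldAffine_klInitial i).add
      (.opMulVec_qklCoeff _ T k i)).isQuantumVariable hΘ hX₀
  · exact (IsFieldAffine.opMulVec_qklCoeff _ T k i).neg.isQuantumVariable hΘ hX₀

theorem theorem2 {n μ : ℕ}
    {H₀ : Type*} [NormedAddCommGroup H₀] [InnerProductSpace ℂ H₀] [CompleteSpace H₀]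
    (Θ R : Matrix (Fin n) (Fin n) ℝ) (M : Matrix (Fin 2 × Fin μ) (Fin n) ℝ)
    (hΘ : Θᵀ = -Θ) (hΘdet : IsUnit Θ) (hR : R.IsSymm)
    (A : Matrix (Fin n) (Fin n) ℝ) (hA : A = driftMatrix Θ R M)
    (B : Matrix (Fin n) (Fin 2 × Fin μ) ℝ) (hB : B = dispersionMatrix Θ M)
    (hHurwitz : IsHurwitz A)
    (X₀ : Fin n → H₀ →ₗ.[ℂ] H₀) (hX₀ : SatisfiesWeylCCR Θ X₀)
    (X : ℝ → Fin n → DomainOp μ X₀) (hX : IsQSDESolution A B X₀ X)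
    (T : ℝ) (hT : 0 < T) :
    (∀ k, IsUnit (mhoInv A T k)) ∧
    ∃ ξ : Fin n → DomainOp μ X₀,
      (∀ i ψ, HasSum
        (fun k => (√(2 / T) : ℂ) • opMulVec (A * mho A T k * B) (qklCoeff X₀ T k) i ψ)
        (ξ i ψ - initialOp μ X₀ i ψ)) ∧
      (∀ i, IsQuantumVariable (ξ i)) ∧
      ∃ α β : ℕ → Fin n → DomainOp μ X₀,
        (∀ k, α k = opMulVec (expCoeff A T k) ξ
          + opMulVec (freq T k • (mho A T k * B)) (qklCoeff X₀ T k)) ∧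
        (∀ k, β k = -opMulVec (A * mho A T k * B) (qklCoeff X₀ T k)) ∧
        (∀ k i, IsQuantumVariable (α k i) ∧ IsQuantumVariable (β k i)) ∧
        ∀ t ∈ Set.Icc 0 T, ∀ i,
          IsQuantumVariable (X t i) ∧
          ∀ ψ, HasSum
            (fun k => (sineFun T k t : ℂ) • α k i ψ + (cosineFun T k t : ℂ) • β k i ψ)
            (X t i ψ - ξ i ψ) := by
  exact ⟨isUnit_mhoInv hHurwitz T, theorem2_general Θ A hΘ B X₀ hX₀ X hX T hT
    (isUnit_mhoInv hHurwitz T)⟩
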